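/- **Setting.** Let $\mathbb T=[-\infty,\infty)$. A rational polyhedron in $\mathbb T^r$ is the closure of a non-empty set $\{x\in\mathbb R^r_I\mid (w_j,x)\le c_j,\ j=1,\dots,k\}$ with $w_j\in\mathbb Z^r$, $c_j\in\mathbb R$, where $\mathbb R^r_I$ is the set of points whose set of infinite coordinates (sedentarity) is exactly $I$; its faces are the closures of the non-empty faces of its intersections with the orbits $\mathbb R^r_J$. Let $X$ be a rational polyhedral space: a paracompact, second countable Hausdorff space with an atlas of homeomorphisms onto open subsets of rational polyhedral subspaces of spaces $\mathbb T^r$ (supports of locally finite rational polyhedral complexes) of uniformly bounded dimension, whose transition maps are continuous and of the form $x\mapsto Ax+b$ with $A$ integral and $b$ real ($0\cdot(-\infty)=0$). An open rational polyhedron is a connected non-empty relatively open subset of a rational polyhedron; if it is a component of $P\cap U$ ($P$ a polyhedron, $U$ open), its faces are the components of the sets $F\cap U$ ($F$ a face of $P$) contained in it. An open rational polyhedral complex is a locally finite family of these, closed under faces, in which every non-empty intersection of two members is a face of both. Let $\mathcal C$ be an open face structure on $X$: a locally finite cover of $X$ by non-empty closed sets (cells) such that for each cell $\sigma$ some chart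 of $X$ contains the closed star $\{\tau\in\mathcal C\mid \exists\,\sigma'\in\mathcal C,\ \tau\subset\sigma',\ \sigma\cap\sigma'\ne\emptyset\}$ and maps its members onto an open rational polyhedral complex. The relative interior $\mathrm{relint}(\sigma)$ is the set of points of $\sigma$ in no proper face, i.e. in no smaller cell. Let $\mathcal X:\ X=X^n\supset X^{n-1}\supset\dots\supset X^0\supset X^{-1}=\emptyset$ be a filtration by closed sets. Its strata $S$ of formal dimension $\dim S=i$ are the connected components of $X^i\smallsetminus X^{i-1}$; put $\operatorname{codim}S=n-\dim S$ and $\Sigma_X=X^{n-1}$. Assume $\mathcal C$ is $\mathcal X$-stratified: for each $\sigma\in\mathcal C$ there is a stratum $S_\sigma\supset\mathrm{relint}(\sigma)$ with $\dim\sigma\le\dim S_\sigma$, and $\dim S_\tau\le\dim S_\sigma$ whenever $\tau$ is a face of $\sigma$. Let $\bar p$ be a perversity, i.e. an integer valued function on the strata that vanishes on the strata of formal dimension $n$; let $Q$ be a Dedekind domain with $\mathbb Z\subset Q\subset\mathbb R$, and $p\ge 0$ an integer. **Chains.** For a cell $\sigma$ of sedentarity $I$ let $\mathbf F_p^{Q}(\sigma)=\Big(\big(\sum_{\sigma'}\bigwedge^p\mathbb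 L(\sigma')\big)\cap\bigwedge^p\mathbb Z^r_I\Big)\otimes_{\mathbb Z} Q$, where $\sigma'$ runs over the cells of sedentarity $I$ containing $\sigma$, $\mathbb L(\sigma')\subset\mathbb R^r_I$ is their linear tangent space in a chart, and $\mathbb Z^r_I,\mathbb R^r_I$ now denote the vectors vanishing on $I$. For $\tau\subset\sigma$ there is a natural map $\mathbf F_p^{Q}(\sigma)\to\mathbf F_p^{Q}(\tau)$, induced by the linear part of the coordinate change followed by forgetting the coordinates in the sedentarity of $\tau$. A $\mathcal C$-stratified $q$-simplex is a continuous map $\delta:\Delta_q\to X$ that maps the relative interior of each face of $\Delta_q$ into the relative interior of some cell. The group of GM tropical $(p,q)$-chains is $${}_{GM}C_{p,q}(X,Q)=\bigoplus_\delta \mathbf F^Q_p(\tau_\delta)\cdot\delta ,$$ where $\tau_\delta$ is the cell with $\delta(\mathrm{relint}\,\Delta_q)\subset\mathrm{relint}(\tau_\delta)$, with boundary map $\partial$, the alternating sum of the faces together with the natural maps of coefficients. The group of non-GM chains $C_{p,q}(X,Q)$ is the subgroup generated by the simplices $\delta$ with $\operatorname{Im}\delta\not\subset\Sigma_X$, with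 boundary map $\hat\partial$ obtained from $\partial$ by omitting the faces contained in $\Sigma_X$. A simplex $\delta$ is allowable if, for each stratum $S$, $\delta^{-1}(S)$ is contained in the $(q-\operatorname{codim}S+\bar p(S))$-skeleton of $\Delta_q$. The group ${}_{(GM)}I^{\bar p}C_{p,q}(X,Q)$ consists of the (GM or non-GM) chains $\xi$ such that all simplices occurring with non-zero coefficient in $\xi$ and in its boundary ($\partial\xi$ in the GM case, $\hat\partial\xi$ in the non-GM case) are allowable; these groups form a complex ${}_{(GM)}I^{\bar p}C_{p,\bullet}(X,Q)$ of $Q$-modules. For $V\subset X$ open, ${}_{(GM)}I^{\bar p}C_{p,\bullet}(V,Q)$ is the subcomplex of the chains whose simplices have image in $V$. Let ${}_{(GM)}I^{\bar p}\Delta^{p,-\bullet}$ be the complex of sheaves of $Q$-modules obtained by sheafifying the complex of presheaves $$U\longmapsto {}_{(GM)}I^{\bar p}C_{p,\bullet}(X,Q)\,/\,{}_{(GM)}I^{\bar p}C_{p,\bullet}(X\smallsetminus\overline U,Q),$$ and let $\Gamma_c$ denote global sections with compact support. **Proposition.** In both the GM and the non-GM version there is an isomorphism of chain complexes of $Q$-modules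 $$\Gamma_c\big({}_{(GM)}I^{\bar p}\Delta^{p,-\bullet}\big)\;\cong\;{}_{(GM)}I^{\bar p}C_{p,\bullet}(X,Q),$$ under which an intersection chain $\xi$ corresponds to the global section defined by the class of $\xi$. -/

import Mathlib

open scoped Topology

namespace TropIH

universe u

noncomputable section

/-! ### Tropical affine space -/

/-- The tropical line `[-∞, ∞)` with the topology induced from the extended real line. -/
abbrev Trop : Type := {x : EReal // x ≠ ⊤}

/-- Tropical affine space of dimension `r`, with the product topology. -/
abbrev TropSpace (r : ℕ) : Type := Fin r → Trop

/-- The real coordinates of a point. Infinite coordinates are replaced by `0`; on the orbit of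
points of sedentarity `I` this identifies the orbit with the real vectors that vanish on `I`. -/
def realPart {r : ℕ} (x : TropSpace r) : Fin r → ℝ := fun i => (x i : EReal).toReal

/-- The sedentarity of a point: the set of its infinite coordinates. -/
def sedPt {r : ℕ} (x : TropSpace r) : Set (Fin r) := {i | (x i : EReal) = ⊥}

/-- The set of all points of sedentarity `I`. -/
def orbit {r : ℕ} (I : Set (Fin r)) : Set (TropSpace r) := {x | sedPt x = I}

/-- The pairing of an integer covector with the real coordinates of a point. -/
def pairing {r : ℕ} (w : Fin r → ℤ) (x : TropSpace r) : ℝ := ∑ i, (w i : ℝ) * realPart x i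

/-- Rational polyhedra in the orbit of sedentarity `I`: solution sets of finitely many affine
inequalities with integral slopes and real constants. -/
def IsPolyhedronIn {r : ℕ} (I : Set (Fin r)) (P : Set (TropSpace r)) : Prop :=
  ∃ (k : ℕ) (w : Fin k → Fin r → ℤ) (c : Fin k → ℝ),
    P = {x ∈ orbit I | ∀ i, pairing (w i) x ≤ c i}

/-- Rational polyhedra in tropical affine space: closures of non-empty rational polyhedra in some
orbit. -/
def IsPolyhedron {r : ℕ} (σ : Set (TropSpace r)) : Prop :=
  ∃ (I : Set (Fin r)) (P : Set (TropSpace r)), IsPolyhedronIn I P ∧ P.Nonempty ∧ σ = closure P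

/-- Faces of a rational polyhedron `σ`: closures of the non-empty faces of the polyhedra
`σ ∩ orbit J`. As usual a face of a polyhedron is the locus where a valid inequality is an
equality; the polyhedron itself (zero covector) is allowed. -/
def IsFace {r : ℕ} (τ σ : Set (TropSpace r)) : Prop :=
  ∃ (J : Set (Fin r)) (w : Fin r → ℤ) (c : ℝ),
    (∀ x ∈ σ ∩ orbit J, pairing w x ≤ c) ∧
    {x ∈ σ ∩ orbit J | pairing w x = c}.Nonempty ∧
    τ = closure {x ∈ σ ∩ orbit J | pairing w x = c}

/-- The relative interior of a polyhedron: the points that lie in no proper face. -/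
def relintPoly {r : ℕ} (σ : Set (TropSpace r)) : Set (TropSpace r) :=
  {x ∈ σ | ∀ τ, IsFace τ σ → τ ≠ σ → x ∉ τ}

/-- The dimension of the affine span of a set of points in one orbit. -/
def affDim {r : ℕ} (s : Set (TropSpace r)) : ℕ :=
  Module.finrank ℝ (vectorSpan ℝ (realPart '' s))

/-- Rational polyhedral complexes in tropical affine space. -/
structure IsPolyhedralComplex {r : ℕ} (C : Set (Set (TropSpace r))) : Prop where
  locallyFinite : LocallyFinite (fun σ : C => (σ : Set (TropSpace r)))
  polyhedron : ∀ σ ∈ C, IsPolyhedron σ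
  face_mem : ∀ σ ∈ C, ∀ τ, IsFace τ σ → τ ∈ C
  inter_face : ∀ σ ∈ C, ∀ σ' ∈ C, (σ ∩ σ').Nonempty →
    IsFace (σ ∩ σ') σ ∧ IsFace (σ ∩ σ') σ'

/-- `S` is the support of a rational polyhedral complex all of whose cells have dimension at most
`n`, i.e. an at most `n`-dimensional rational polyhedral subspace. -/
def IsPolyhedralSubspace {r : ℕ} (n : ℕ) (S : Set (TropSpace r)) : Prop :=
  ∃ C, IsPolyhedralComplex C ∧ S = ⋃₀ C ∧ ∀ σ ∈ C, affDim (relintPoly σ) ≤ n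

/-- Open rational polyhedra: connected (hence non-empty) relatively open subsets of polyhedra. -/
def IsOpenPolyhedron {r : ℕ} (σ : Set (TropSpace r)) : Prop :=
  ∃ P U, IsPolyhedron P ∧ IsOpen U ∧ σ = P ∩ U ∧ IsConnected σ

/-- Faces of an open polyhedron `σ`: if `σ` is a connected component of `P ∩ U`, the connected
components of `Q ∩ U` contained in `σ`, where `Q` is a face of `P`. -/
def IsOpenFace {r : ℕ} (τ σ : Set (TropSpace r)) : Prop :=
  ∃ P U Q, IsPolyhedron P ∧ IsOpen U ∧
    (∃ x ∈ P ∩ U, σ = connectedComponentIn (P ∩ U) x) ∧ IsFace Q P ∧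
    (∃ y ∈ Q ∩ U, τ = connectedComponentIn (Q ∩ U) y) ∧ τ ⊆ σ

/-- Open rational polyhedral complexes. The cells need not be closed in the ambient space, and
local finiteness is only asked for at the points of the support. -/
structure IsOpenComplex {r : ℕ} (C : Set (Set (TropSpace r))) : Prop where
  locallyFinite : ∀ x ∈ ⋃₀ C, ∃ V ∈ 𝓝 x, {σ ∈ C | (σ ∩ V).Nonempty}.Finite
  polyhedron : ∀ σ ∈ C, IsOpenPolyhedron σ
  face_mem : ∀ σ ∈ C, ∀ τ, IsOpenFace τ σ → τ ∈ C
  inter_face : ∀ σ ∈ C, ∀ σ' ∈ C, (σ ∩ σ').Nonempty →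
    IsOpenFace (σ ∩ σ') σ ∧ IsOpenFace (σ ∩ σ') σ'

/-- The map `f` is given on `M` by `x ↦ A x + b`, where `0 · (-∞) = 0`; the first condition says
that the expression makes sense, i.e. that `-∞` is never multiplied by a negative number. -/
def IsAffineOn {m n : ℕ} (A : Matrix (Fin n) (Fin m) ℤ) (b : Fin n → ℝ)
    (f : TropSpace m → TropSpace n) (M : Set (TropSpace m)) : Prop :=
  ∀ x ∈ M, ∀ k, (∀ i, (x i : EReal) = ⊥ → 0 ≤ A k i) ∧
    (f x k : EReal) = ∑ i, (((A k i : ℤ) : ℝ) : EReal) * (x i : EReal) + ((b k : ℝ) : EReal)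

/-- Extended affine `ℤ`-linear maps on a subset `M` of tropical affine space. -/
def IsExtendedAffineOn {m n : ℕ} (f : TropSpace m → TropSpace n) (M : Set (TropSpace m)) : Prop :=
  ContinuousOn f M ∧ ∃ A b, IsAffineOn A b f M

/-! ### Rational polyhedral spaces -/

/-- A chart: a homeomorphism from an open subset of `X` onto an open subset of a rational
polyhedral subspace. The value of `toFun` outside `source` is irrelevant. -/
structure Chart (X : Type u) [TopologicalSpace X] where
  r : ℕ
  source : Set X
  open_source : IsOpen source
  toFun : X → TropSpace r
  isEmbedding : Topology.IsEmbedding (source.domRestrict toFun)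
  model : Set (TropSpace r)
  model_subspace : ∃ n, IsPolyhedralSubspace n model
  image_open : ∃ V, IsOpen V ∧ toFun '' source = model ∩ V

/-- An atlas turning `X` into a rational polyhedral space (for `X` paracompact, second countable
and Hausdorff). -/
structure RationalPolyhedralAtlas (X : Type u) [TopologicalSpace X] where
  charts : Set (Chart X)
  cover : ∀ x, ∃ φ ∈ charts, x ∈ φ.source
  transition : ∀ φ ∈ charts, ∀ ψ ∈ charts, ∃ f : TropSpace φ.r → TropSpace ψ.r,
    IsExtendedAffineOn f (φ.toFun '' (φ.source ∩ ψ.source)) ∧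
    ∀ x ∈ φ.source ∩ ψ.source, f (φ.toFun x) = ψ.toFun x
  dim_bound : ∃ N, ∀ φ ∈ charts, IsPolyhedralSubspace N φ.model

/-- The closed star of `σ` in a family of sets: the members that are contained in some member
meeting `σ`. -/
def closedStar {X : Type u} (cells : Set (Set X)) (σ : Set X) : Set (Set X) :=
  {τ ∈ cells | ∃ σ' ∈ cells, τ ⊆ σ' ∧ (σ ∩ σ').Nonempty}

/-- Open face structures on a rational polyhedral space. For every cell a chart of the atlas is
chosen that contains the closed star and turns it into an open rational polyhedral complex. -/
structure OpenFaceStructure {X : Type u} [TopologicalSpace X]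
    (𝒜 : RationalPolyhedralAtlas X) where
  cells : Set (Set X)
  nonempty : ∀ σ ∈ cells, σ.Nonempty
  closed : ∀ σ ∈ cells, IsClosed σ
  locallyFinite : LocallyFinite (fun σ : cells => (σ : Set X))
  cover : ⋃₀ cells = Set.univ
  chart : cells → Chart X
  chart_mem : ∀ σ, chart σ ∈ 𝒜.charts
  star_subset : ∀ σ : cells, ∀ τ ∈ closedStar cells σ, τ ⊆ (chart σ).source
  star_complex : ∀ σ : cells,
    IsOpenComplex {s | ∃ τ ∈ closedStar cells σ, s = (chart σ).toFun '' τ}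

/-! ### Elementary facts on charts and cells -/

section Geometry

variable {r : ℕ}

/-- The sedentarity of a set: the coordinates that are infinite on the whole set. For a
polyhedron this is the sedentarity of its relative interior. -/
def sedSet (s : Set (TropSpace r)) : Set (Fin r) := {i | ∀ x ∈ s, (x i : EReal) = ⊥}

/-- The linear space of directions tangent to `σ`, where `σ` has sedentarity `I`: the direction
of the affine span of `σ ∩ orbit I`. -/
def tangentSpan (σ : Set (TropSpace r)) : Submodule ℝ (Fin r → ℝ) :=
  vectorSpan ℝ (realPart '' (σ ∩ orbit (sedSet σ)))

lemma sedSet_anti {s t : Set (TropSpace r)} (h : s ⊆ t) : sedSet t ⊆ sedSet s :=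
  fun _ hi x hx => hi x (h hx)

lemma sedPt_of_mem {s : Set (TropSpace r)} {x : TropSpace r} (hx : x ∈ s) :
    sedSet s ⊆ sedPt x := fun _ hi => hi x hx

lemma isClosed_sed (I : Set (Fin r)) : IsClosed {x : TropSpace r | I ⊆ sedPt x} := by
  have : {x : TropSpace r | I ⊆ sedPt x} = ⋂ i ∈ I, {x | (x i : EReal) = ⊥} := by
    ext x
    simp [sedPt, Set.subset_def]
  rw [this]
  refine isClosed_biInter fun i _ => ?_
  exact isClosed_eq (continuous_subtype_val.comp (continuous_apply i)) continuous_const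

lemma sed_closure {I : Set (Fin r)} {P : Set (TropSpace r)} (hP : P ⊆ orbit I)
    {x : TropSpace r} (hx : x ∈ closure P) : I ⊆ sedPt x := by
  have : closure P ⊆ {x : TropSpace r | I ⊆ sedPt x} :=
    closure_minimal (fun y hy => (hP hy : sedPt y = I).symm.subset) (isClosed_sed I)
  exact this hx

/-- An open polyhedron contains a point with the sedentarity of the set, and such points are
dense. -/
lemma IsOpenPolyhedron.exists_generic {σ : Set (TropSpace r)} (h : IsOpenPolyhedron σ) :
    (σ ∩ orbit (sedSet σ)).Nonempty ∧ σ ⊆ closure (σ ∩ orbit (sedSet σ)) := by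
  obtain ⟨P, U, ⟨I, P₀, ⟨k, w, c, hP₀⟩, -, rfl⟩, hU, rfl, hc⟩ := h
  have hsub : P₀ ⊆ orbit I := by rw [hP₀]; exact fun x hx => hx.1
  have hdense : closure P₀ ∩ U ⊆ closure (P₀ ∩ U) := hU.closure_inter
  obtain ⟨x, hx⟩ := hc.nonempty
  have hne : (P₀ ∩ U).Nonempty := by
    rw [← closure_nonempty_iff]
    exact ⟨x, hdense hx⟩
  have hs : sedSet (closure P₀ ∩ U) = I := by
    apply Set.Subset.antisymm
    · obtain ⟨y, hy⟩ := hne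
      have : sedPt y = I := hsub hy.1
      rw [← this]
      exact sedPt_of_mem ⟨subset_closure hy.1, hy.2⟩
    · exact fun i hi y hy => sed_closure hsub hy.1 hi
  rw [hs]
  have hin : P₀ ∩ U ⊆ closure P₀ ∩ U ∩ orbit I :=
    fun y hy => ⟨⟨subset_closure hy.1, hy.2⟩, hsub hy.1⟩
  exact ⟨hne.mono hin, hdense.trans (closure_mono hin)⟩

/-- The point with infinite coordinates in `J` and real coordinates `v` elsewhere. -/
def mkPt (J : Set (Fin r)) (v : Fin r → ℝ) : TropSpace r := by
  classical
  exact fun i => if i ∈ J then ⟨⊥, bot_ne_top⟩ else ⟨(v i : EReal), EReal.coe_ne_top _⟩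

lemma mkPt_mem {J : Set (Fin r)} {v : Fin r → ℝ} {i : Fin r} (h : i ∈ J) :
    (mkPt J v i : EReal) = ⊥ := by simp [mkPt, h]

lemma mkPt_notMem {J : Set (Fin r)} {v : Fin r → ℝ} {i : Fin r} (h : i ∉ J) :
    (mkPt J v i : EReal) = v i := by simp [mkPt, h]

lemma sedPt_mkPt (J : Set (Fin r)) (v : Fin r → ℝ) : sedPt (mkPt J v) = J := by
  ext i
  by_cases h : i ∈ J
  · simp [sedPt, mkPt_mem h, h]
  · simp [sedPt, mkPt_notMem h, h]

/-- Setting the coordinates in `J` to zero. -/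
def proj (J : Set (Fin r)) : (Fin r → ℝ) →ₗ[ℝ] (Fin r → ℝ) where
  toFun v := Jᶜ.indicator v
  map_add' v w := Set.indicator_add Jᶜ v w
  map_smul' a v := Set.indicator_const_smul Jᶜ a v

lemma proj_mem {J : Set (Fin r)} (v : Fin r → ℝ) {i : Fin r} (h : i ∈ J) : proj J v i = 0 := by
  simp [proj, h]

lemma proj_notMem {J : Set (Fin r)} (v : Fin r → ℝ) {i : Fin r} (h : i ∉ J) :
    proj J v i = v i := by
  simp [proj, h]

lemma realPart_mkPt (J : Set (Fin r)) (v : Fin r → ℝ) : realPart (mkPt J v) = proj J v := by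
  ext i
  by_cases h : i ∈ J
  · simp [realPart, mkPt_mem h, proj_mem v h]
  · simp [realPart, mkPt_notMem h, proj_notMem v h]

lemma realPart_of_mem_sedPt {x : TropSpace r} {i : Fin r} (h : i ∈ sedPt x) :
    realPart x i = 0 := by
  have : (x i : EReal) = ⊥ := h
  simp [realPart, this]

lemma coe_realPart {x : TropSpace r} {i : Fin r} (h : i ∉ sedPt x) :
    ((realPart x i : ℝ) : EReal) = x i := EReal.coe_toReal (x i).2 h

lemma continuous_mkPt (J : Set (Fin r)) : Continuous (mkPt J : (Fin r → ℝ) → TropSpace r) := by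
  refine continuous_pi fun i => ?_
  by_cases h : i ∈ J
  · simp only [mkPt, h, if_true]
    exact continuous_const
  · simp only [mkPt, h, if_false]
    exact (continuous_coe_real_ereal.comp (continuous_apply i)).subtype_mk _

/-- Moving from a point of a polyhedron towards a point of its closure. -/
lemma convex_mem {I J : Set (Fin r)} {P : Set (TropSpace r)} (hP : IsPolyhedronIn I P)
    {x z : TropSpace r} (hx : x ∈ P) (hz : z ∈ closure P) (hzJ : sedPt z = J)
    {t : ℝ} (h0 : 0 < t) (h1 : t ≤ 1) :
    mkPt J ((1 - t) • realPart x + t • realPart z) ∈ closure P := by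
  obtain ⟨k, w, c, rfl⟩ := hP
  have hxI : sedPt x = I := hx.1
  have hIJ : I ⊆ J := hzJ ▸ sed_closure (fun y hy => hy.1) hz
  have hne : ∀ (i : Fin r) (a : Trop),
      (((1 - t) * realPart x i : ℝ) : EReal) + (t : EReal) * (a : EReal) ≠ ⊤ := by
    intro i a
    refine EReal.add_ne_top (EReal.coe_ne_top _) ?_
    rcases eq_or_ne (a : EReal) ⊥ with ha | ha
    · rw [ha, EReal.coe_mul_bot_of_pos h0]
      exact bot_ne_top
    · rw [← EReal.coe_toReal a.2 ha, ← EReal.coe_mul]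
      exact EReal.coe_ne_top _
  let g : TropSpace r → TropSpace r := fun y i =>
    ⟨(((1 - t) * realPart x i : ℝ) : EReal) + (t : EReal) * (y i : EReal), hne i (y i)⟩
  have hg : Continuous g := by
    refine continuous_pi fun i => Continuous.subtype_mk ?_ _
    have h2 : Continuous fun y : TropSpace r => (t : EReal) * (y i : EReal) := by
      refine continuous_iff_continuousAt.2 fun y => ?_
      have ht : (t : EReal) ≠ 0 := by exact_mod_cast h0.ne'
      exact EReal.Tendsto.const_mul
        (continuous_subtype_val.comp (continuous_apply i)).continuousAt (Or.inl (EReal.coe_ne_bot _)) (Or.inl (EReal.coe_ne_top _))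
    refine continuous_iff_continuousAt.2 fun y => ?_
    exact ContinuousAt.comp (f := fun y : TropSpace r =>
        ((((1 - t) * realPart x i : ℝ) : EReal), (t : EReal) * (y i : EReal)))
      (EReal.continuousAt_add (Or.inl (EReal.coe_ne_top _)) (Or.inl (EReal.coe_ne_bot _)))
      (continuous_const.prodMk h2).continuousAt
  have hgeq : ∀ y : TropSpace r, I ⊆ sedPt y →
      g y = mkPt (sedPt y) ((1 - t) • realPart x + t • realPart y) := by
    intro y hy
    ext i
    by_cases h : i ∈ sedPt y
    · have h' : (y i : EReal) = ⊥ := h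
      simp only [g, mkPt_mem h, h', EReal.coe_mul_bot_of_pos h0, EReal.add_bot]
    · rw [mkPt_notMem h]
      simp only [g, Pi.add_apply, Pi.smul_apply, smul_eq_mul, EReal.coe_add, EReal.coe_mul,
        coe_realPart h]
  have hmaps : Set.MapsTo g {x ∈ orbit I | ∀ i, pairing (w i) x ≤ c i}
      {x ∈ orbit I | ∀ i, pairing (w i) x ≤ c i} := by
    intro y hy
    have hyI : sedPt y = I := hy.1
    rw [hgeq y hyI.symm.subset]
    refine ⟨by rw [orbit, Set.mem_ofPred_eq, sedPt_mkPt, hyI], fun i => ?_⟩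
    have hpr : realPart (mkPt (sedPt y) ((1 - t) • realPart x + t • realPart y)) =
        (1 - t) • realPart x + t • realPart y := by
      rw [realPart_mkPt]
      ext j
      by_cases hj : j ∈ sedPt y
      · rw [proj_mem _ hj]
        have hjx : j ∈ sedPt x := by rw [hxI, ← hyI]; exact hj
        simp [realPart_of_mem_sedPt hj, realPart_of_mem_sedPt hjx]
      · rw [proj_notMem _ hj]
    have : pairing (w i) (mkPt (sedPt y) ((1 - t) • realPart x + t • realPart y)) =
        (1 - t) * pairing (w i) x + t * pairing (w i) y := by
      simp only [pairing, hpr, Pi.add_apply, Pi.smul_apply, smul_eq_mul, Finset.mul_sum,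
        ← Finset.sum_add_distrib]
      exact Finset.sum_congr rfl fun j _ => by ring
    rw [this]
    nlinarith [hx.2 i, hy.2 i]
  have := map_mem_closure hg hz hmaps
  rwa [hgeq z (hzJ ▸ hIJ), hzJ] at this

/-- Projecting the tangent space of a cell to the orbit of one of its faces lands in the tangent
space of a cell with the sedentarity of the face. -/
lemma IsOpenComplex.exists_proj {D : Set (Set (TropSpace r))} (hD : IsOpenComplex D)
    {σ τ : Set (TropSpace r)} (hσ : σ ∈ D) (hτ : τ ∈ D) (hτσ : τ ⊆ σ) :
    ∃ ρ ∈ D, τ ⊆ ρ ∧ sedSet ρ = sedSet τ ∧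
      ∀ v ∈ tangentSpan σ, proj (sedSet τ) v ∈ tangentSpan ρ := by
  obtain ⟨⟨z, hzτ, hz⟩, hτd⟩ := (hD.polyhedron τ hτ).exists_generic
  set J := sedSet τ with hJ
  have hz : sedPt z = J := hz
  obtain ⟨P, U, ⟨I, P₀, hP₀, hPne, rfl⟩, hU, hσeq, hσc⟩ := hD.polyhedron σ hσ
  have hzσ : z ∈ closure P₀ ∩ U := hσeq ▸ hτσ hzτ
  -- the part of the closed polyhedron of sedentarity `J`
  set F : Set (TropSpace r) := {x ∈ closure P₀ ∩ orbit J | pairing (0 : Fin r → ℤ) x = 0} with hF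
  have hFeq : F = closure P₀ ∩ orbit J := by
    ext x
    simp [hF, pairing]
  have hzF : z ∈ F := by rw [hFeq]; exact ⟨hzσ.1, hz⟩
  have hFcl : closure F ⊆ closure P₀ :=
    closure_minimal (fun x hx => hx.1.1) isClosed_closure
  have hface : IsFace (closure F) (closure P₀) :=
    ⟨J, 0, 0, fun x _ => by simp [pairing], ⟨z, hzF⟩, rfl⟩
  set ρ := connectedComponentIn (closure F ∩ U) z with hρ
  have hzFU : z ∈ closure F ∩ U := ⟨subset_closure hzF, hzσ.2⟩
  have hzρ : z ∈ ρ := mem_connectedComponentIn hzFU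
  have hρσ : ρ ⊆ σ := by
    rw [hσeq]
    exact (connectedComponentIn_subset _ _).trans (Set.inter_subset_inter_left _ hFcl)
  have hρface : IsOpenFace ρ σ := by
    refine ⟨closure P₀, U, closure F, ⟨I, P₀, hP₀, hPne, rfl⟩, hU, ⟨z, hzσ, ?_⟩, hface,
      ⟨z, hzFU, rfl⟩, hρσ⟩
    rw [hσeq] at hσc ⊢
    exact (hσc.isPreconnected.connectedComponentIn hzσ).symm
  have hρD : ρ ∈ D := hD.face_mem σ hσ ρ hρface
  have hτρ : τ ⊆ ρ := by
    obtain ⟨P', U', -, -, -, hτc⟩ := hD.polyhedron τ hτ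
    refine hτc.isPreconnected.subset_connectedComponentIn hzτ fun x hx => ⟨?_, ?_⟩
    · refine closure_mono ?_ (hτd hx)
      intro y hy
      rw [hFeq]
      exact ⟨(hσeq ▸ hτσ hy.1 : y ∈ closure P₀ ∩ U).1, hy.2⟩
    · exact (hσeq ▸ hτσ hx : x ∈ closure P₀ ∩ U).2
  have hρJ : sedSet ρ = J := by
    apply Set.Subset.antisymm (sedSet_anti hτρ)
    intro i hi x hx
    have hx' : x ∈ closure F := (connectedComponentIn_subset _ _ hx).1
    exact sed_closure (fun y hy => hy.1.2) hx' hi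
  refine ⟨ρ, hρD, hτρ, hρJ, ?_⟩
  have hP₀I : P₀ ⊆ orbit I := by
    obtain ⟨k, w, c, rfl⟩ := hP₀
    exact fun y hy => hy.1
  -- points of `σ` of generic sedentarity lie in `P₀`
  have hσI : sedSet σ = I := by
    obtain ⟨y, hyU, hyP⟩ := mem_closure_iff.1 hzσ.1 U hU hzσ.2
    apply Set.Subset.antisymm
    · have h1 : sedPt y = I := hP₀I hyP
      rw [← h1]
      exact sedPt_of_mem (by rw [hσeq]; exact ⟨subset_closure hyP, hyU⟩)
    · intro i hi x hx
      exact sed_closure hP₀I (hσeq ▸ hx : x ∈ closure P₀ ∩ U).1 hi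
  have hPclosed : closure P₀ ∩ orbit I ⊆ P₀ := by
    obtain ⟨k, w, c, rfl⟩ := hP₀
    rintro x ⟨hx, hxI⟩
    refine ⟨hxI, fun i => ?_⟩
    have hcont : ContinuousWithinAt (pairing (w i)) {x ∈ orbit I | ∀ i, pairing (w i) x ≤ c i}
        x := by
      refine tendsto_finsetSum _ fun j _ => Filter.Tendsto.const_mul _ ?_
      by_cases hj : j ∈ I
      · refine tendsto_const_nhds.congr' ?_
        filter_upwards [self_mem_nhdsWithin] with y hy
        have hyI : sedPt y = I := hy.1
        have hxI' : sedPt x = I := hxI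
        rw [realPart_of_mem_sedPt (x := y) (by rw [hyI]; exact hj),
          realPart_of_mem_sedPt (x := x) (by rw [hxI']; exact hj)]
      · have hxj : (x j : EReal) ≠ ⊥ := fun h => hj ((hxI : sedPt x = I) ▸ h)
        exact ((EReal.tendsto_toReal (x j).2 hxj).comp
          ((continuous_subtype_val.comp (continuous_apply j)).tendsto x)).mono_left
          nhdsWithin_le_nhds
    have hmem : pairing (w i) x ∈ closure (Set.Iic (c i)) :=
      hcont.mem_closure hx fun y hy => hy.2 i
    rwa [isClosed_Iic.closure_eq] at hmem
  -- moving from a generic point towards `z` stays in `ρ` near `z`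
  have hnear : ∀ x ∈ P₀, ∀ᶠ s in 𝓝[<] (1 : ℝ),
      mkPt J ((1 - s) • realPart x + s • realPart z) ∈ ρ := by
    intro x hx
    set γ : ℝ → TropSpace r := fun s => mkPt J ((1 - s) • realPart x + s • realPart z) with hγ
    have hγc : Continuous γ := (continuous_mkPt J).comp (by fun_prop)
    have hγ1 : γ 1 = z := by
      ext i
      by_cases hi : i ∈ J
      · rw [hγ, mkPt_mem hi]
        exact ((hz ▸ hi : i ∈ sedPt z) : (z i : EReal) = ⊥).symm
      · rw [hγ, mkPt_notMem hi]
        simp [coe_realPart (hz ▸ hi : i ∉ sedPt z)]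
    have hU1 : ∀ᶠ s in 𝓝[≤] (1 : ℝ), γ s ∈ U :=
      (hγc.continuousAt.eventually (hγ1 ▸ hU.mem_nhds hzσ.2)).filter_mono nhdsWithin_le_nhds
    obtain ⟨a, ha1, ha⟩ := (mem_nhdsLE_iff_exists_Ioc_subset).1 hU1
    have hmax : max a 0 < 1 := max_lt ha1 one_pos
    filter_upwards [Ioo_mem_nhdsLT hmax] with s hs
    have hpre : IsPreconnected (γ '' Set.Icc s 1) :=
      isPreconnected_Icc.image _ hγc.continuousOn
    refine hpre.subset_connectedComponentIn (x := z) ⟨1, ⟨hs.2.le, le_rfl⟩, hγ1⟩ ?_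
      ⟨s, ⟨le_rfl, hs.2.le⟩, rfl⟩
    rintro _ ⟨t, ⟨ht1, ht2⟩, rfl⟩
    have ht0 : max a 0 < t := hs.1.trans_le ht1
    refine ⟨subset_closure ?_, ha ⟨(le_max_left _ _).trans_lt ht0, ht2⟩⟩
    rw [hFeq]
    exact ⟨convex_mem hP₀ hx hzσ.1 hz ((le_max_right _ _).trans_lt ht0) ht2,
      sedPt_mkPt J _⟩
  intro v hv
  refine Submodule.span_induction (p := fun v _ => proj J v ∈ tangentSpan ρ) ?_ ?_ ?_ ?_ hv
  · rintro _ ⟨_, ⟨x, ⟨hxσ, hxs⟩, rfl⟩, _, ⟨y, ⟨hyσ, hys⟩, rfl⟩, rfl⟩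
    rw [hσI] at hxs hys
    have hx : x ∈ P₀ := hPclosed ⟨(hσeq ▸ hxσ : x ∈ closure P₀ ∩ U).1, hxs⟩
    have hy : y ∈ P₀ := hPclosed ⟨(hσeq ▸ hyσ : y ∈ closure P₀ ∩ U).1, hys⟩
    obtain ⟨s, ⟨hsx, hsy⟩, hs1⟩ :=
      (((hnear x hx).and (hnear y hy)).and self_mem_nhdsWithin).exists
    have hs1 : s < 1 := hs1
    have h1 : (realPart (mkPt J ((1 - s) • realPart x + s • realPart z)) -
        realPart (mkPt J ((1 - s) • realPart y + s • realPart z))) ∈ tangentSpan ρ := by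
      refine vsub_mem_vectorSpan ℝ ?_ ?_
      · exact ⟨_, ⟨hsx, by rw [hρJ]; exact sedPt_mkPt J _⟩, rfl⟩
      · exact ⟨_, ⟨hsy, by rw [hρJ]; exact sedPt_mkPt J _⟩, rfl⟩
    have h2 : proj J (realPart x -ᵥ realPart y) = (1 - s)⁻¹ •
        (realPart (mkPt J ((1 - s) • realPart x + s • realPart z)) -
        realPart (mkPt J ((1 - s) • realPart y + s • realPart z))) := by
      rw [realPart_mkPt, realPart_mkPt, ← map_sub, add_sub_add_right_eq_sub, ← smul_sub, map_smul,
        smul_smul, inv_mul_cancel₀ (by linarith), one_smul, vsub_eq_sub]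
    rw [h2]
    exact Submodule.smul_mem _ _ h1
  · simp
  · intro x y _ _ hx hy
    rw [map_add]
    exact Submodule.add_mem _ hx hy
  · intro a x _ hx
    rw [map_smul]
    exact Submodule.smul_mem _ _ hx

end Geometry

lemma ereal_coe_sum {ι : Type*} (s : Finset ι) (f : ι → ℝ) :
    ((∑ i ∈ s, f i : ℝ) : EReal) = ∑ i ∈ s, (f i : EReal) := by
  classical
  induction s using Finset.induction_on with
  | empty => simp
  | insert a s ha ih => rw [Finset.sum_insert ha, Finset.sum_insert ha, EReal.coe_add, ih]

namespace OpenFaceStructure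

variable {X : Type u} [TopologicalSpace X] {𝒜 : RationalPolyhedralAtlas X}
  (C : OpenFaceStructure 𝒜)

/-- The cells of an open face structure. -/
abbrev Cell : Type u := {σ : Set X // σ ∈ C.cells}

/-- The image of a set in the chart chosen for the cell `σ`. -/
def img (σ : C.Cell) (s : Set X) : Set (TropSpace (C.chart σ).r) := (C.chart σ).toFun '' s

variable {C}

lemma mem_star {σ τ : C.Cell} (h : (σ.1 ∩ τ.1).Nonempty) : τ.1 ∈ closedStar C.cells σ :=
  ⟨τ.2, τ.1, τ.2, subset_rfl, h⟩

lemma mem_star_of_le {σ τ : C.Cell} (h : σ.1 ⊆ τ.1) : τ.1 ∈ closedStar C.cells σ :=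
  mem_star (by rw [Set.inter_eq_left.2 h]; exact C.nonempty _ σ.2)

lemma subset_source {σ τ : C.Cell} (h : σ.1 ⊆ τ.1) : τ.1 ⊆ (C.chart σ).source :=
  C.star_subset σ _ (mem_star_of_le h)

lemma injOn_chart (σ : C.Cell) : Set.InjOn (C.chart σ).toFun (C.chart σ).source :=
  Set.injOn_iff_injective.2 (C.chart σ).isEmbedding.injective

lemma img_inter (σ : C.Cell) {s t : Set X} (hs : s ⊆ (C.chart σ).source)
    (ht : t ⊆ (C.chart σ).source) : C.img σ s ∩ C.img σ t = C.img σ (s ∩ t) :=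
  ((injOn_chart σ).image_inter hs ht).symm

lemma img_inj (σ : C.Cell) {s t : Set X} (hs : s ⊆ (C.chart σ).source)
    (ht : t ⊆ (C.chart σ).source) (h : C.img σ s = C.img σ t) : s = t :=
  ((injOn_chart σ).image_eq_image_iff hs ht).1 h

lemma inter_mem {σ τ : C.Cell} (h : (σ.1 ∩ τ.1).Nonempty) : σ.1 ∩ τ.1 ∈ C.cells := by
  have hσ := mem_star_of_le (σ := σ) (τ := σ) subset_rfl
  have hτ := mem_star h
  have hσs := C.star_subset σ _ hσ
  have hτs := C.star_subset σ _ hτ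
  have hD := C.star_complex σ
  have hf := (hD.inter_face (C.img σ σ) ⟨_, hσ, rfl⟩ (C.img σ τ) ⟨_, hτ, rfl⟩ (by
    rw [img_inter σ hσs hτs]
    exact h.image _)).1
  obtain ⟨ρ, hρ, he⟩ := hD.face_mem _ ⟨_, hσ, rfl⟩ _ hf
  rw [img_inter σ hσs hτs] at he
  rw [img_inj σ (Set.inter_subset_left.trans hσs) (C.star_subset σ _ hρ) he]
  exact hρ.1

/-- Among the cells of the closed star of `σ`, being a face is the same as being contained. -/
lemma isOpenFace_iff_subset (σ : C.Cell) {τ τ' : Set X} (hτ : τ ∈ closedStar C.cells σ)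
    (hτ' : τ' ∈ closedStar C.cells σ) : IsOpenFace (C.img σ τ) (C.img σ τ') ↔ τ ⊆ τ' := by
  have hs := C.star_subset σ _ hτ
  have hs' := C.star_subset σ _ hτ'
  constructor
  · rintro ⟨-, -, -, -, -, -, -, -, h⟩
    exact ((injOn_chart σ).image_subset_image_iff hs hs').1 h
  · intro h
    have := ((C.star_complex σ).inter_face (C.img σ τ) ⟨_, hτ, rfl⟩ (C.img σ τ') ⟨_, hτ', rfl⟩ (by
      rw [img_inter σ hs hs', Set.inter_eq_left.2 h]
      exact (C.nonempty _ hτ.1).image _)).2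
    rwa [img_inter σ hs hs', Set.inter_eq_left.2 h] at this

variable (C)

/-- The relative interior of a cell: the points that lie in no proper face. -/
def relint (σ : C.Cell) : Set X := {x ∈ σ.1 | ∀ τ : C.Cell, τ.1 ⊆ σ.1 → τ ≠ σ → x ∉ τ.1}

variable {C}

/-- The relative interior agrees with the one computed in the chart. -/
lemma mem_relint_iff (σ : C.Cell) {x : X} (hx : x ∈ σ.1) : x ∈ C.relint σ ↔
    ∀ t, IsOpenFace t (C.img σ σ) → t ≠ C.img σ σ → (C.chart σ).toFun x ∉ t := by
  have hσ := mem_star_of_le (σ := σ) (τ := σ) subset_rfl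
  have hσs := C.star_subset σ _ hσ
  constructor
  · rintro ⟨-, h⟩ t ht hne hxt
    obtain ⟨τ, hτ, rfl⟩ := (C.star_complex σ).face_mem _ ⟨_, hσ, rfl⟩ t ht
    have hτs := C.star_subset σ _ hτ
    have hsub := (isOpenFace_iff_subset σ hτ hσ).1 ht
    refine h ⟨τ, hτ.1⟩ hsub (fun he => hne ?_) ?_
    · rw [← he]; rfl
    · exact ((injOn_chart σ).mem_image_iff hτs (hσs hx)).1 hxt
  · intro h
    refine ⟨hx, fun τ hτ hne hxτ => ?_⟩
    have hτ' : τ.1 ∈ closedStar C.cells σ := mem_star ⟨x, hx, hxτ⟩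
    refine h (C.img σ τ) ((isOpenFace_iff_subset σ hτ' hσ).2 hτ) (fun he => hne ?_) ⟨x, hxτ, rfl⟩
    exact Subtype.ext (img_inj σ (C.star_subset σ _ hτ') hσs he)

/-- A cell meeting the relative interior of another cell contains that cell. -/
lemma subset_of_mem_relint {σ τ : C.Cell} {x : X} (hx : x ∈ C.relint τ) (hxσ : x ∈ σ.1) :
    τ.1 ⊆ σ.1 := by
  by_contra h
  have hm := inter_mem (σ := τ) (τ := σ) ⟨x, hx.1, hxσ⟩
  refine hx.2 ⟨_, hm⟩ Set.inter_subset_left (fun he => h ?_) ⟨hx.1, hxσ⟩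
  exact Set.inter_eq_left.1 (congrArg Subtype.val he)

variable (C)

/-- The dimension of a cell. -/
def cellDim (σ : C.Cell) : ℕ := affDim (C.img σ (C.relint σ))

/-! ### Multi-tangents -/

/-- The sedentarity of a cell in its chart. -/
def sed (σ : C.Cell) : Set (Fin (C.chart σ).r) := sedSet (C.img σ σ)

lemma exists_trans (σ τ : C.Cell) :
    ∃ (A : Matrix (Fin (C.chart τ).r) (Fin (C.chart σ).r) ℤ) (b : Fin (C.chart τ).r → ℝ),
      ∀ x ∈ (C.chart σ).source ∩ (C.chart τ).source, ∀ k,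
        (∀ i, ((C.chart σ).toFun x i : EReal) = ⊥ → 0 ≤ A k i) ∧
        ((C.chart τ).toFun x k : EReal) = ∑ i, (((A k i : ℤ) : ℝ) : EReal) *
          ((C.chart σ).toFun x i : EReal) + ((b k : ℝ) : EReal) := by
  obtain ⟨f, ⟨-, A, b, h⟩, hf⟩ := 𝒜.transition _ (C.chart_mem σ) _ (C.chart_mem τ)
  refine ⟨A, b, fun x hx k => ?_⟩
  have := h _ ⟨x, hx, rfl⟩ k
  rwa [hf x hx] at this

/-- An integer matrix describing the linear part of the transition map from the chart of `σ` to the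
chart of `τ`. -/
def transMatrix (σ τ : C.Cell) : Matrix (Fin (C.chart τ).r) (Fin (C.chart σ).r) ℤ :=
  (C.exists_trans σ τ).choose

/-- The constant part of the transition map. -/
def transConst (σ τ : C.Cell) : Fin (C.chart τ).r → ℝ := (C.exists_trans σ τ).choose_spec.choose

variable {C}

lemma trans_nonneg {σ τ : C.Cell} {x : X} (hσ : x ∈ (C.chart σ).source)
    (hτ : x ∈ (C.chart τ).source) (k : Fin (C.chart τ).r) {i : Fin (C.chart σ).r}
    (hi : i ∈ sedPt ((C.chart σ).toFun x)) : 0 ≤ C.transMatrix σ τ k i :=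
  ((C.exists_trans σ τ).choose_spec.choose_spec x ⟨hσ, hτ⟩ k).1 i hi

lemma trans_eq {σ τ : C.Cell} {x : X} (hσ : x ∈ (C.chart σ).source)
    (hτ : x ∈ (C.chart τ).source) (k : Fin (C.chart τ).r) :
    ((C.chart τ).toFun x k : EReal) = ∑ i, (((C.transMatrix σ τ k i : ℤ) : ℝ) : EReal) *
      ((C.chart σ).toFun x i : EReal) + ((C.transConst σ τ k : ℝ) : EReal) :=
  ((C.exists_trans σ τ).choose_spec.choose_spec x ⟨hσ, hτ⟩ k).2

lemma trans_eq_zero {σ τ : C.Cell} {x : X} (hσ : x ∈ (C.chart σ).source)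
    (hτ : x ∈ (C.chart τ).source) {k : Fin (C.chart τ).r}
    (hk : k ∉ sedPt ((C.chart τ).toFun x)) {i : Fin (C.chart σ).r}
    (hi : i ∈ sedPt ((C.chart σ).toFun x)) : C.transMatrix σ τ k i = 0 := by
  by_contra hne
  have hpos : 0 < C.transMatrix σ τ k i := lt_of_le_of_ne (trans_nonneg hσ hτ k hi) (Ne.symm hne)
  apply hk
  have hi' : ((C.chart σ).toFun x i : EReal) = ⊥ := hi
  change ((C.chart τ).toFun x k : EReal) = ⊥
  rw [trans_eq hσ hτ k, ← Finset.add_sum_erase _ _ (Finset.mem_univ i), hi',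
    EReal.coe_mul_bot_of_pos (by exact_mod_cast hpos), EReal.bot_add, EReal.bot_add]

lemma trans_coe {σ τ : C.Cell} {x : X} (hσ : x ∈ (C.chart σ).source)
    (hτ : x ∈ (C.chart τ).source) {k : Fin (C.chart τ).r}
    (hk : ∀ i ∈ sedPt ((C.chart σ).toFun x), C.transMatrix σ τ k i = 0) :
    ((C.chart τ).toFun x k : EReal) = ((∑ i, (C.transMatrix σ τ k i : ℝ) *
      realPart ((C.chart σ).toFun x) i + C.transConst σ τ k : ℝ) : EReal) := by
  rw [trans_eq hσ hτ k, EReal.coe_add, ereal_coe_sum]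
  congr 1
  refine Finset.sum_congr rfl fun i _ => ?_
  by_cases hi : i ∈ sedPt ((C.chart σ).toFun x)
  · rw [hk i hi]
    simp
  · rw [EReal.coe_mul, coe_realPart hi]

variable (C)

/-- The linear map induced by the transition from the chart of `σ` to the chart of `τ`, followed by
the projection that forgets the coordinates in the sedentarity of `τ`. -/
def lin (σ τ : C.Cell) : (Fin (C.chart σ).r → ℝ) →ₗ[ℝ] (Fin (C.chart τ).r → ℝ) :=
  proj (C.sed τ) ∘ₗ Matrix.toLin' ((C.transMatrix σ τ).map (Int.cast : ℤ → ℝ))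

variable {C}

lemma sedPt_trans {σ τ ρ : C.Cell} (hσ : σ.1 ⊆ ρ.1) (hτ : τ.1 ⊆ ρ.1) {x : X} (hx : x ∈ ρ.1)
    (hg : sedPt ((C.chart σ).toFun x) = sedSet (C.img σ ρ)) :
    sedPt ((C.chart τ).toFun x) = sedSet (C.img τ ρ) := by
  apply Set.Subset.antisymm
  · rintro k hk _ ⟨w, hw, rfl⟩
    by_contra hkw
    have h0 : ∀ i ∈ sedPt ((C.chart σ).toFun x), C.transMatrix σ τ k i = 0 := by
      intro i hi
      refine trans_eq_zero (subset_source hσ hw) (subset_source hτ hw) hkw ?_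
      rw [hg] at hi
      exact hi _ ⟨w, hw, rfl⟩
    have hk' : ((C.chart τ).toFun x k : EReal) = ⊥ := hk
    rw [trans_coe (subset_source hσ hx) (subset_source hτ hx) h0] at hk'
    exact EReal.coe_ne_bot _ hk'
  · exact sedPt_of_mem ⟨x, hx, rfl⟩

lemma lin_sub {σ τ ρ : C.Cell} (hσ : σ.1 ⊆ ρ.1) (hτ : τ.1 ⊆ ρ.1) {x y : X} (hx : x ∈ ρ.1)
    (hy : y ∈ ρ.1) (hgx : sedPt ((C.chart σ).toFun x) = sedSet (C.img σ ρ))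
    (hgy : sedPt ((C.chart σ).toFun y) = sedSet (C.img σ ρ)) :
    Matrix.toLin' ((C.transMatrix σ τ).map (Int.cast : ℤ → ℝ))
      (realPart ((C.chart σ).toFun x) - realPart ((C.chart σ).toFun y)) -
      (realPart ((C.chart τ).toFun x) - realPart ((C.chart τ).toFun y)) ∈
      LinearMap.ker (proj (C.sed τ)) := by
  have key : ∀ z ∈ ρ.1, sedPt ((C.chart σ).toFun z) = sedSet (C.img σ ρ) → ∀ k ∉ C.sed τ,
      realPart ((C.chart τ).toFun z) k = ∑ i, (C.transMatrix σ τ k i : ℝ) *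
        realPart ((C.chart σ).toFun z) i + C.transConst σ τ k := by
    intro z hz hg k hk
    have hkz : k ∉ sedPt ((C.chart τ).toFun z) := by
      rw [sedPt_trans hσ hτ hz hg]
      exact fun h => hk (sedSet_anti (Set.image_mono hτ) h)
    have h0 := trans_coe (k := k) (subset_source hσ hz) (subset_source hτ hz) fun i hi =>
      trans_eq_zero (subset_source hσ hz) (subset_source hτ hz) hkz hi
    rw [realPart, h0, EReal.toReal_coe]
  rw [LinearMap.mem_ker]
  ext k
  by_cases hk : k ∈ C.sed τ
  · rw [proj_mem _ hk]; rfl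
  · rw [proj_notMem _ hk]
    simp only [Matrix.toLin'_apply, Matrix.mulVec, dotProduct, Matrix.map_apply, Pi.sub_apply,
      key x hx hgx k hk, key y hy hgy k hk, Pi.zero_apply, mul_sub, Finset.sum_sub_distrib]
    ring

lemma lin_sub_eq {σ τ ρ : C.Cell} (hσ : σ.1 ⊆ ρ.1) (hτ : τ.1 ⊆ ρ.1) {x y : X} (hx : x ∈ ρ.1)
    (hy : y ∈ ρ.1) (hgx : sedPt ((C.chart σ).toFun x) = sedSet (C.img σ ρ))
    (hgy : sedPt ((C.chart σ).toFun y) = sedSet (C.img σ ρ)) :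
    C.lin σ τ (realPart ((C.chart σ).toFun x) - realPart ((C.chart σ).toFun y)) =
      proj (C.sed τ) (realPart ((C.chart τ).toFun x) - realPart ((C.chart τ).toFun y)) := by
  have := lin_sub hσ hτ hx hy hgx hgy
  rw [LinearMap.mem_ker, map_sub, sub_eq_zero] at this
  exact this

/-- Induction on tangent vectors: they are combinations of differences of generic points. -/
lemma tangent_induction {σ ρ : C.Cell} {V : Type*} [AddCommGroup V] [Module ℝ V]
    (f : (Fin (C.chart σ).r → ℝ) →ₗ[ℝ] V) (W : Submodule ℝ V)
    (h : ∀ x ∈ ρ.1, ∀ y ∈ ρ.1, sedPt ((C.chart σ).toFun x) = sedSet (C.img σ ρ) →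
      sedPt ((C.chart σ).toFun y) = sedSet (C.img σ ρ) →
      f (realPart ((C.chart σ).toFun x) - realPart ((C.chart σ).toFun y)) ∈ W) :
    ∀ v ∈ tangentSpan (C.img σ ρ), f v ∈ W := by
  intro v hv
  have : tangentSpan (C.img σ ρ) ≤ W.comap f := by
    refine Submodule.span_le.2 ?_
    rintro _ ⟨_, ⟨_, ⟨⟨x, hx, rfl⟩, hgx⟩, rfl⟩, _, ⟨_, ⟨⟨y, hy, rfl⟩, hgy⟩, rfl⟩, rfl⟩
    exact h x hx y hy hgx hgy
  exact this hv

lemma exists_lin {σ τ ρ : C.Cell} (hτσ : τ.1 ⊆ σ.1) (hσρ : σ.1 ⊆ ρ.1) :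
    ∃ ρ' : C.Cell, τ.1 ⊆ ρ'.1 ∧ sedSet (C.img τ ρ') = C.sed τ ∧
      ∀ v ∈ tangentSpan (C.img σ ρ), C.lin σ τ v ∈ tangentSpan (C.img τ ρ') := by
  have hτρ := hτσ.trans hσρ
  obtain ⟨_, ⟨ρ', hρ', rfl⟩, hsub, hsed, hv⟩ := (C.star_complex τ).exists_proj
    (σ := C.img τ ρ) (τ := C.img τ τ) ⟨_, mem_star_of_le hτρ, rfl⟩
    ⟨_, mem_star_of_le subset_rfl, rfl⟩ (Set.image_mono hτρ)
  refine ⟨⟨ρ', hρ'.1⟩, ?_, hsed, ?_⟩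
  · exact ((injOn_chart τ).image_subset_image_iff (subset_source subset_rfl)
      (C.star_subset τ _ hρ')).1 hsub
  · refine tangent_induction _ _ fun x hx y hy hgx hgy => ?_
    rw [lin_sub_eq hσρ hτρ hx hy hgx hgy]
    refine hv _ (vsub_mem_vectorSpan ℝ ?_ ?_)
    · exact ⟨_, ⟨⟨x, hx, rfl⟩, sedPt_trans hσρ hτρ hx hgx⟩, rfl⟩
    · exact ⟨_, ⟨⟨y, hy, rfl⟩, sedPt_trans hσρ hτρ hy hgy⟩, rfl⟩

lemma lin_lin {σ τ ρ κ : C.Cell} (hτσ : τ.1 ⊆ σ.1) (hκτ : κ.1 ⊆ τ.1) (hσρ : σ.1 ⊆ ρ.1) :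
    ∀ v ∈ tangentSpan (C.img σ ρ), C.lin τ κ (C.lin σ τ v) = C.lin σ κ v := by
  have hτρ := hτσ.trans hσρ
  have hκρ := hκτ.trans hτρ
  intro v hv
  rw [← sub_eq_zero]
  refine tangent_induction (C.lin τ κ ∘ₗ C.lin σ τ - C.lin σ κ) ⊥
    (fun x hx y hy hgx hgy => ?_) v hv
  rw [Submodule.mem_bot, LinearMap.sub_apply, LinearMap.comp_apply, sub_eq_zero,
    lin_sub_eq hσρ hτρ hx hy hgx hgy, lin_sub_eq hσρ hκρ hx hy hgx hgy,
    ← lin_sub_eq hτρ hκρ hx hy (sedPt_trans hσρ hτρ hx hgx) (sedPt_trans hσρ hτρ hy hgy)]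
  -- forgetting the coordinates in the sedentarity of `τ` first makes no difference
  ext k
  by_cases hk : k ∈ C.sed κ
  · simp [lin, proj_mem _ hk]
  · simp only [lin, LinearMap.comp_apply, proj_notMem _ hk, Matrix.toLin'_apply, Matrix.mulVec,
      dotProduct, Matrix.map_apply]
    refine Finset.sum_congr rfl fun i _ => ?_
    by_cases hi : i ∈ C.sed τ
    · obtain ⟨_, ⟨w, hw, rfl⟩, hwg⟩ := (((C.star_complex κ).polyhedron (C.img κ κ)
        ⟨_, mem_star_of_le subset_rfl, rfl⟩).exists_generic).1
      have hk' : k ∉ sedPt ((C.chart κ).toFun w) := by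
        rw [show sedPt ((C.chart κ).toFun w) = C.sed κ from hwg]
        exact hk
      rw [trans_eq_zero (subset_source (σ := τ) (τ := τ) subset_rfl (hκτ hw))
        (subset_source (σ := κ) (τ := κ) subset_rfl hw) hk' (hi _ ⟨w, hκτ hw, rfl⟩)]
      simp
    · rw [proj_notMem _ hi]

variable (C)

/-- The real multi-tangent space of degree `p` at `σ`: the sum of the exterior powers of the
tangent spaces of the cells of the same sedentarity that contain `σ`. -/
def multiTangentReal (p : ℕ) (σ : C.Cell) : Submodule ℝ (⋀[ℝ]^p (Fin (C.chart σ).r → ℝ)) :=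
  ⨆ ρ : {ρ : C.Cell // σ.1 ⊆ ρ.1 ∧ sedSet (C.img σ ρ) = C.sed σ},
    LinearMap.range (exteriorPower.map p (tangentSpan (C.img σ ρ.1)).subtype)

end OpenFaceStructure

/-- The exterior power of the lattice of integer vectors vanishing on `I`. -/
def wedgeLattice (p : ℕ) {r : ℕ} (I : Set (Fin r)) : Submodule ℤ (⋀[ℝ]^p (Fin r → ℝ)) :=
  Submodule.span ℤ {ω | ∃ v : Fin p → Fin r → ℤ, (∀ j, ∀ i ∈ I, v j i = 0) ∧
    ω = exteriorPower.ιMulti ℝ p (fun j i => (v j i : ℝ))}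

namespace OpenFaceStructure

variable {X : Type u} [TopologicalSpace X] {𝒜 : RationalPolyhedralAtlas X}
  (C : OpenFaceStructure 𝒜)

/-- The integral multi-tangent of degree `p` at `σ`. -/
def multiTangentInt (p : ℕ) (σ : C.Cell) : Submodule ℤ (⋀[ℝ]^p (Fin (C.chart σ).r → ℝ)) :=
  (C.multiTangentReal p σ).restrictScalars ℤ ⊓ wedgeLattice p (C.sed σ)

variable {C}

lemma map_multiTangentReal (p : ℕ) {σ τ : C.Cell} (h : τ.1 ⊆ σ.1) :
    ∀ ω ∈ C.multiTangentReal p σ, exteriorPower.map p (C.lin σ τ) ω ∈ C.multiTangentReal p τ := by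
  intro ω hω
  have : C.multiTangentReal p σ ≤
      (C.multiTangentReal p τ).comap (exteriorPower.map p (C.lin σ τ)) := by
    refine iSup_le ?_
    rintro ⟨ρ, hσρ, -⟩ _ ⟨η, rfl⟩
    obtain ⟨ρ', hτρ', hsed, hv⟩ := exists_lin h hσρ
    refine (le_iSup (fun ρ : {ρ : C.Cell // τ.1 ⊆ ρ.1 ∧ sedSet (C.img τ ρ) = C.sed τ} =>
      LinearMap.range (exteriorPower.map p (tangentSpan (C.img τ ρ.1)).subtype))
      ⟨ρ', hτρ', hsed⟩) ?_
    refine ⟨exteriorPower.map p ((C.lin σ τ).restrict hv) η, ?_⟩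
    rw [← LinearMap.comp_apply, ← exteriorPower.map_comp, ← LinearMap.comp_apply,
      ← exteriorPower.map_comp]
    rfl
  exact this hω

lemma map_wedgeLattice (p : ℕ) (σ τ : C.Cell) :
    ∀ ω ∈ wedgeLattice p (C.sed σ),
      exteriorPower.map p (C.lin σ τ) ω ∈ wedgeLattice p (C.sed τ) := by
  classical
  intro ω hω
  have : wedgeLattice p (C.sed σ) ≤ (wedgeLattice p (C.sed τ)).comap
      ((exteriorPower.map p (C.lin σ τ)).restrictScalars ℤ) := by
    refine Submodule.span_le.2 ?_
    rintro _ ⟨v, -, rfl⟩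
    refine Submodule.subset_span
      ⟨fun j k => if k ∈ C.sed τ then 0 else (C.transMatrix σ τ).mulVec (v j) k, ?_, ?_⟩
    · intro j i hi
      simp [hi]
    · rw [LinearMap.restrictScalars_apply, exteriorPower.map_apply_ιMulti]
      congr 1
      ext j k
      by_cases hk : k ∈ C.sed τ
      · simp [lin, proj_mem _ hk, hk]
      · simp [lin, proj_notMem _ hk, hk, Matrix.mulVec, dotProduct]
  exact this hω

/-- The natural map from the integral multi-tangent of a cell to that of a face. -/
def faceMap (p : ℕ) {σ τ : C.Cell} (h : τ.1 ⊆ σ.1) :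
    C.multiTangentInt p σ →ₗ[ℤ] C.multiTangentInt p τ :=
  ((exteriorPower.map p (C.lin σ τ)).restrictScalars ℤ).restrict fun ω hω =>
    ⟨map_multiTangentReal p h ω hω.1, map_wedgeLattice p σ τ ω hω.2⟩

lemma faceMap_faceMap (p : ℕ) {σ τ κ : C.Cell} (h : τ.1 ⊆ σ.1) (h' : κ.1 ⊆ τ.1) :
    faceMap p h' ∘ₗ faceMap p h = faceMap p (h'.trans h) := by
  ext1 ω
  apply Subtype.ext
  have : C.multiTangentReal p σ ≤ LinearMap.eqLocus
      (exteriorPower.map p (C.lin τ κ) ∘ₗ exteriorPower.map p (C.lin σ τ))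
      (exteriorPower.map p (C.lin σ κ)) := by
    refine iSup_le ?_
    rintro ⟨ρ, hσρ, -⟩ _ ⟨η, rfl⟩
    rw [LinearMap.mem_eqLocus, ← exteriorPower.map_comp, ← LinearMap.comp_apply,
      ← LinearMap.comp_apply, ← exteriorPower.map_comp, ← exteriorPower.map_comp]
    congr 2
    ext1 v
    exact lin_lin h h' hσρ v.1 v.2
  exact this ω.2.1

variable (C)

/-- The multi-tangent with coefficients in `Q`. -/
def MultiTangent (Q : Subring ℝ) (p : ℕ) (σ : C.Cell) : Type :=
  TensorProduct ℤ Q (C.multiTangentInt p σ)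

instance (Q : Subring ℝ) (p : ℕ) (σ : C.Cell) : AddCommGroup (C.MultiTangent Q p σ) :=
  inferInstanceAs (AddCommGroup (TensorProduct ℤ Q (C.multiTangentInt p σ)))

instance (Q : Subring ℝ) (p : ℕ) (σ : C.Cell) : Module Q (C.MultiTangent Q p σ) :=
  inferInstanceAs (Module Q (TensorProduct ℤ Q (C.multiTangentInt p σ)))

variable {C}

/-- The natural map from the multi-tangent of a cell to that of a face. -/
def faceMapQ (Q : Subring ℝ) (p : ℕ) {σ τ : C.Cell} (h : τ.1 ⊆ σ.1) :
    C.MultiTangent Q p σ →ₗ[Q] C.MultiTangent Q p τ :=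
  (faceMap p h).baseChange Q

lemma faceMapQ_faceMapQ (Q : Subring ℝ) (p : ℕ) {σ τ κ : C.Cell} (h : τ.1 ⊆ σ.1)
    (h' : κ.1 ⊆ τ.1) (v : C.MultiTangent Q p σ) :
    faceMapQ Q p h' (faceMapQ Q p h v) = faceMapQ Q p (h'.trans h) v := by
  have h1 : (faceMap p h').baseChange Q ∘ₗ (faceMap p h).baseChange Q =
      (faceMap p (h'.trans h)).baseChange Q := by
    rw [← LinearMap.baseChange_comp, faceMap_faceMap]
  exact LinearMap.congr_fun h1 v

end OpenFaceStructure

/-! ### Filtered spaces, strata and perversities -/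

/-- A filtration `X = X^n ⊇ X^(n-1) ⊇ ⋯ ⊇ X^0 ⊇ X^(-1) = ∅` by closed sets, where `n` is the formal
dimension; `level i` is `X^i` (and hence `X` for `i ≥ n` and empty for `i < 0`). -/
structure Filtration (X : Type u) [TopologicalSpace X] where
  dim : ℕ
  level : ℤ → Set X
  mono : Monotone level
  closed : ∀ i, IsClosed (level i)
  level_dim : level dim = Set.univ
  level_neg : level (-1) = ∅

namespace Filtration

variable {X : Type u} [TopologicalSpace X] (𝒳 : Filtration X)

/-- The pure part `X_i = X^i ∖ X^(i-1)`. -/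
def pure (i : ℤ) : Set X := 𝒳.level i \ 𝒳.level (i - 1)

/-- The singular locus `X^(n-1)`. -/
def singular : Set X := 𝒳.level (𝒳.dim - 1)

/-- Strata: connected components of the pure parts. The formal dimension is determined by the
set, since strata are non-empty and the pure parts are disjoint. -/
structure Stratum where
  dim : ℤ
  carrier : Set X
  isComponent : ∃ x ∈ 𝒳.pure dim, carrier = connectedComponentIn (𝒳.pure dim) x

/-- The formal codimension of a stratum. -/
def codim (S : 𝒳.Stratum) : ℤ := 𝒳.dim - S.dim

/-- Perversities: integer valued functions on strata vanishing on the regular strata. -/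
structure Perversity where
  val : 𝒳.Stratum → ℤ
  regular : ∀ S : 𝒳.Stratum, S.dim = 𝒳.dim → val S = 0

end Filtration

/-- The open face structure is stratified with respect to the filtration. -/
def OpenFaceStructure.IsStratified {X : Type u} [TopologicalSpace X]
    {𝒜 : RationalPolyhedralAtlas X} (C : OpenFaceStructure 𝒜) (𝒳 : Filtration X) : Prop :=
  ∃ S : C.Cell → 𝒳.Stratum,
    (∀ σ, C.relint σ ⊆ (S σ).carrier ∧ (C.cellDim σ : ℤ) ≤ (S σ).dim) ∧
    ∀ τ σ : C.Cell, τ.1 ⊆ σ.1 → (S τ).dim ≤ (S σ).dim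

/-! ### Stratified simplices -/

/-- The standard `q`-simplex, in barycentric coordinates. -/
abbrev Δ (q : ℕ) : Type := stdSimplex ℝ (Fin (q + 1))

/-- The inclusion of the `j`-th facet of the standard simplex. -/
def facet {q : ℕ} (j : Fin (q + 2)) : C(Δ q, Δ (q + 1)) :=
  ⟨stdSimplex.map j.succAbove, stdSimplex.continuous_map _⟩

lemma facet_succAbove {q : ℕ} (j : Fin (q + 2)) (x : Δ q) (i : Fin (q + 1)) :
    facet j x (j.succAbove i) = x i := by
  change FunOnFinite.linearMap ℝ ℝ j.succAbove x (j.succAbove i) = x i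
  rw [FunOnFinite.linearMap_apply_apply]
  simp [Finset.filter_eq']

lemma facet_self {q : ℕ} (j : Fin (q + 2)) (x : Δ q) : facet j x j = 0 := by
  change FunOnFinite.linearMap ℝ ℝ j.succAbove x j = 0
  rw [FunOnFinite.linearMap_apply_apply]
  simp [Fin.succAbove_ne]

lemma facet_facet {q : ℕ} {i : Fin (q + 3)} {j : Fin (q + 2)} (h : i ≤ j.castSucc) (x : Δ q) :
    facet j.succ (facet (i.castLT (lt_of_le_of_lt h j.is_lt)) x) = facet i (facet j x) := by
  change stdSimplex.map _ (stdSimplex.map _ x) = stdSimplex.map _ (stdSimplex.map _ x)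
  rw [stdSimplex.map_comp_apply, stdSimplex.map_comp_apply]
  congr 1
  ext k
  have h' : i.val ≤ j.val := h
  simp only [Function.comp_apply, Fin.succAbove, Fin.lt_def]
  split_ifs <;> simp_all <;> omega

/-- For every non-empty set of vertices the open face spanned by it is non-empty. -/
lemma exists_support {q : ℕ} (J : Finset (Fin (q + 1))) (hJ : J.Nonempty) :
    ∃ x : Δ q, ∀ i, x i ≠ 0 ↔ i ∈ J := by
  have hc : (J.card : ℝ) ≠ 0 := by exact_mod_cast hJ.card_pos.ne'
  refine ⟨⟨fun i => if i ∈ J then (J.card : ℝ)⁻¹ else 0, fun i => ?_, ?_⟩, fun i => ?_⟩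
  · dsimp only
    split_ifs
    · positivity
    · exact le_rfl
  · simp [Finset.sum_ite_mem, hc]
  · change (if i ∈ J then (J.card : ℝ)⁻¹ else 0) ≠ 0 ↔ i ∈ J
    split_ifs with hi <;> simp [hi, hc]

/-- A closed set that contains the image of the interior of the simplex contains the image of the
simplex. -/
lemma mem_of_interior {q : ℕ} {X : Type u} [TopologicalSpace X] (f : C(Δ q, X)) {s : Set X}
    (hs : IsClosed s) (h : ∀ x : Δ q, (∀ i, x i ≠ 0) → f x ∈ s) (x : Δ q) : f x ∈ s := by
  obtain ⟨b, hb⟩ := exists_support (Finset.univ : Finset (Fin (q + 1))) Finset.univ_nonempty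
  have hb : ∀ i, b i ≠ 0 := fun i => (hb i).2 (Finset.mem_univ i)
  let t : ℕ → ℝ := fun n => 1 / ((n : ℝ) + 1)
  have ht0 : ∀ n, 0 < t n := fun n => by positivity
  have ht1 : ∀ n, t n ≤ 1 := fun n => by
    rw [div_le_one (by positivity)]
    have : (0 : ℝ) ≤ n := n.cast_nonneg
    linarith
  let y : ℕ → Δ q := fun n => ⟨(1 - t n) • x.1 + t n • b.1,
    convex_stdSimplex ℝ _ x.2 b.2 (by linarith [ht1 n]) (ht0 n).le (by ring)⟩
  have hy : Filter.Tendsto y Filter.atTop (𝓝 x) := by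
    rw [tendsto_subtype_rng]
    have ht : Filter.Tendsto t Filter.atTop (𝓝 0) := tendsto_one_div_add_atTop_nhds_zero_nat
    have h1 : Filter.Tendsto (fun n => (1 - t n) • x.1 + t n • b.1) Filter.atTop
        (𝓝 ((1 - (0 : ℝ)) • x.1 + (0 : ℝ) • b.1)) :=
      ((tendsto_const_nhds.sub ht).smul tendsto_const_nhds).add (ht.smul tendsto_const_nhds)
    simpa using h1
  refine hs.mem_of_tendsto ((f.continuous.tendsto x).comp hy) (Filter.Eventually.of_forall ?_)
  intro n
  refine h _ fun i => ne_of_gt ?_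
  have hx0 : 0 ≤ x.1 i := x.2.1 i
  have hb0 : 0 < b.1 i := lt_of_le_of_ne (b.2.1 i) (Ne.symm (hb i))
  have h2 : 0 < t n * b.1 i := mul_pos (ht0 n) hb0
  have h3 : 0 ≤ (1 - t n) * x.1 i := mul_nonneg (by linarith [ht1 n]) hx0
  change 0 < (1 - t n) * x.1 i + t n * b.1 i
  linarith

/-- Stratified singular `q`-simplices: the relative interior of every face is mapped into the
relative interior of a cell. A face is given by its non-empty set `J` of vertices. -/
@[ext]
structure Simplex {X : Type u} [TopologicalSpace X] {𝒜 : RationalPolyhedralAtlas X}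
    (C : OpenFaceStructure 𝒜) (q : ℕ) where
  toMap : C(Δ q, X)
  stratified : ∀ J : Finset (Fin (q + 1)), J.Nonempty →
    ∃ τ : C.Cell, ∀ x : Δ q, (∀ i, x i ≠ 0 ↔ i ∈ J) → toMap x ∈ C.relint τ

namespace Simplex

variable {X : Type u} [TopologicalSpace X] {𝒜 : RationalPolyhedralAtlas X}
  {C : OpenFaceStructure 𝒜} {q : ℕ}

instance : DecidableEq (Simplex C q) := Classical.decEq _

/-- The unique cell whose relative interior contains the image of the interior of the simplex. -/
def cell (δ : Simplex C q) : C.Cell := (δ.stratified Finset.univ Finset.univ_nonempty).choose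

lemma mem_relint_cell (δ : Simplex C q) (x : Δ q) (hx : ∀ i, x i ≠ 0) :
    δ.toMap x ∈ C.relint δ.cell :=
  (δ.stratified Finset.univ Finset.univ_nonempty).choose_spec x (by simpa using hx)

lemma mem_cell (δ : Simplex C q) (x : Δ q) : δ.toMap x ∈ δ.cell.1 :=
  mem_of_interior δ.toMap (C.closed _ δ.cell.2) (fun y hy => (δ.mem_relint_cell y hy).1) x

/-- The `j`-th face of a stratified simplex. -/
def face (δ : Simplex C (q + 1)) (j : Fin (q + 2)) : Simplex C q where
  toMap := δ.toMap.comp (facet j)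
  stratified J hJ := by
    obtain ⟨τ, hτ⟩ := δ.stratified (J.map j.succAboveEmb) (hJ.map)
    refine ⟨τ, fun x hx => hτ _ fun i => ?_⟩
    rcases Fin.eq_self_or_eq_succAbove j i with rfl | ⟨k, rfl⟩
    · simp [facet_self, Fin.succAbove_ne]
    · simp [facet_succAbove, hx]

lemma face_face (δ : Simplex C (q + 2)) {i : Fin (q + 3)} {j : Fin (q + 2)}
    (h : i ≤ j.castSucc) :
    (δ.face j.succ).face (i.castLT (lt_of_le_of_lt h j.is_lt)) = (δ.face i).face j := by
  ext x
  exact congrArg δ.toMap (facet_facet h x)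

lemma cell_face_subset (δ : Simplex C (q + 1)) (j : Fin (q + 2)) :
    (δ.face j).cell.1 ⊆ δ.cell.1 := by
  obtain ⟨x, hx⟩ := exists_support (Finset.univ : Finset (Fin (q + 1))) Finset.univ_nonempty
  exact OpenFaceStructure.subset_of_mem_relint
    ((δ.face j).mem_relint_cell x fun i => (hx i).2 (Finset.mem_univ i)) (δ.mem_cell _)

lemma range_face_subset (δ : Simplex C (q + 1)) (j : Fin (q + 2)) :
    Set.range (δ.face j).toMap ⊆ Set.range δ.toMap := by
  rintro _ ⟨x, rfl⟩
  exact ⟨facet j x, rfl⟩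

/-- Allowability: the preimage of each stratum `S` lies in the skeleton of dimension
`q - codim S + p(S)`, i.e. its points have at most `q - codim S + p(S) + 1` non-zero barycentric
coordinates. -/
def Allowable {𝒳 : Filtration X} (pv : 𝒳.Perversity) (δ : Simplex C q) : Prop :=
  ∀ S : 𝒳.Stratum, ∀ x : Δ q, δ.toMap x ∈ S.carrier →
    (Nat.card {i // x i ≠ 0} : ℤ) ≤ q - 𝒳.codim S + pv.val S + 1

end Simplex

/-! ### Tropical chains -/

/-- The two versions of intersection chains. -/
inductive Version where
  | GM
  | nonGM

section Chains

variable {X : Type u} [TopologicalSpace X] {𝒜 : RationalPolyhedralAtlas X}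
  (C : OpenFaceStructure 𝒜) (Q : Subring ℝ) (p : ℕ)

/-- Tropical `(p, q)`-chains: finite combinations of stratified simplices, where the coefficient
of a simplex lies in the multi-tangent of its cell. -/
abbrev Chain (q : ℕ) : Type u := Π₀ δ : Simplex C q, C.MultiTangent Q p δ.cell

/-- The `j`-th face map on chains. -/
def faceChain (q : ℕ) (j : Fin (q + 2)) : Chain C Q p (q + 1) →ₗ[Q] Chain C Q p q :=
  DFinsupp.lsum ℕ fun δ => DFinsupp.lsingle (δ.face j) ∘ₗ
    OpenFaceStructure.faceMapQ Q p (δ.cell_face_subset j)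

variable {C Q p}

lemma faceChain_single {q : ℕ} (j : Fin (q + 2)) (δ : Simplex C (q + 1))
    (v : C.MultiTangent Q p δ.cell) :
    faceChain C Q p q j (DFinsupp.single δ v) = DFinsupp.single (δ.face j)
      (OpenFaceStructure.faceMapQ Q p (δ.cell_face_subset j) v) := by
  simp [faceChain]

lemma single_congr {q : ℕ} {σ : C.Cell} (v : C.MultiTangent Q p σ) {δ δ' : Simplex C q}
    (h : δ = δ') (hδ : δ.cell.1 ⊆ σ.1) (hδ' : δ'.cell.1 ⊆ σ.1) :
    (DFinsupp.single δ (OpenFaceStructure.faceMapQ Q p hδ v) : Chain C Q p q) =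
      DFinsupp.single δ' (OpenFaceStructure.faceMapQ Q p hδ' v) := by
  subst h
  rfl

lemma faceChain_faceChain {q : ℕ} {i : Fin (q + 3)} {j : Fin (q + 2)} (h : i ≤ j.castSucc) :
    faceChain C Q p q (i.castLT (lt_of_le_of_lt h j.is_lt)) ∘ₗ faceChain C Q p (q + 1) j.succ =
      faceChain C Q p q j ∘ₗ faceChain C Q p (q + 1) i := by
  refine DFinsupp.lhom_ext fun δ v => ?_
  simp only [LinearMap.comp_apply, faceChain_single, OpenFaceStructure.faceMapQ_faceMapQ]
  exact single_congr v (δ.face_face h) _ _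

variable (C Q p)

/-- The boundary map of tropical chains. -/
def boundary (q : ℕ) : Chain C Q p (q + 1) →ₗ[Q] Chain C Q p q :=
  ∑ j : Fin (q + 2), (-1 : Q) ^ (j : ℕ) • faceChain C Q p q j

lemma boundary_boundary (q : ℕ) : boundary C Q p q ∘ₗ boundary C Q p (q + 1) = 0 := by
  have hexp : boundary C Q p q ∘ₗ boundary C Q p (q + 1) =
      ∑ i : Fin (q + 2), ∑ j : Fin (q + 3), ((-1 : Q) ^ (i : ℕ) • faceChain C Q p q i) ∘ₗ
        ((-1 : Q) ^ (j : ℕ) • faceChain C Q p (q + 1) j) := by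
    ext1 δ
    ext1 v
    simp only [boundary, LinearMap.comp_apply, LinearMap.sum_apply, map_sum]
    rw [Finset.sum_comm]
  rw [hexp, ← Finset.sum_product']
  let P := Fin (q + 2) × Fin (q + 3)
  let S : Finset P := {ij : P | (ij.2 : ℕ) ≤ (ij.1 : ℕ)}
  rw [Finset.univ_product_univ, ← Finset.sum_add_sum_compl S, ← eq_neg_iff_add_eq_zero,
    ← Finset.sum_neg_distrib]
  let φ : ∀ ij : P, ij ∈ S → P := fun ij hij =>
    (Fin.castLT ij.2 (lt_of_le_of_lt (Finset.mem_filter.mp hij).right (Fin.is_lt ij.1)), ij.1.succ)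
  apply Finset.sum_bij φ
  · intro ij hij
    simp_rw [S, φ, Finset.compl_filter, Finset.mem_filter_univ, Fin.val_succ,
      Fin.val_castLT] at hij ⊢
    lia
  · rintro ⟨i, j⟩ hij ⟨i', j'⟩ hij' h
    rw [Prod.mk_inj]
    exact ⟨by simpa [φ] using! congr_arg Prod.snd h,
      by simpa [φ, Fin.castSucc_castLT] using! congr_arg Fin.castSucc (congr_arg Prod.fst h)⟩
  · rintro ⟨i', j'⟩ hij'
    simp_rw [S, Finset.compl_filter, Finset.mem_filter_univ, not_le] at hij'
    refine ⟨(j'.pred <| ?_, Fin.castSucc i'), ?_, ?_⟩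
    · rintro rfl
      simp only [Fin.val_zero, not_lt_zero] at hij'
    · simpa [S] using! Nat.le_sub_one_of_lt hij'
    · simp only [φ, Fin.castLT_castSucc, Fin.succ_pred]
  · rintro ⟨i, j⟩ hij
    have hij' : j ≤ i.castSucc := by simpa [S] using! hij
    simp only [LinearMap.smul_comp, LinearMap.comp_smul, smul_smul, ← neg_smul, φ,
      faceChain_faceChain hij', Fin.val_succ, Fin.val_castLT]
    congr 1
    ring

variable (𝒳 : Filtration X)

/-- In the non-GM version only the simplices that are not contained in the singular locus are
kept. (As the singular locus is closed, it contains the simplex as soon as it contains the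
interior of the simplex.) -/
def Keep (g : Version) {q : ℕ} (δ : Simplex C q) : Prop :=
  g = Version.GM ∨ ¬ Set.range δ.toMap ⊆ 𝒳.singular

/-- Dropping the simplices that are not kept. -/
def keepProj (g : Version) (q : ℕ) : Chain C Q p q →ₗ[Q] Chain C Q p q := by
  classical
  exact DFinsupp.filterLinearMap Q _ (Keep C 𝒳 g)

/-- The boundary map: the ordinary one in the GM version, while in the non-GM version the faces
contained in the singular locus are dropped. -/
def bdry (g : Version) (q : ℕ) : Chain C Q p (q + 1) →ₗ[Q] Chain C Q p q :=
  keepProj C Q p 𝒳 g q ∘ₗ boundary C Q p q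

lemma keepProj_GM (q : ℕ) : keepProj C Q p 𝒳 Version.GM q = LinearMap.id := by
  classical
  ext1 δ
  ext1 v
  simp [keepProj, DFinsupp.filter_single, Keep]

variable {C Q p 𝒳}

lemma keepProj_single (g : Version) {q : ℕ} (δ : Simplex C q) (v : C.MultiTangent Q p δ.cell)
    (h : ¬ Keep C 𝒳 g δ) : keepProj C Q p 𝒳 g q (DFinsupp.single δ v) = 0 := by
  classical
  simp [keepProj, h]

lemma keepProj_single_of_keep (g : Version) {q : ℕ} (δ : Simplex C q)
    (v : C.MultiTangent Q p δ.cell) (h : Keep C 𝒳 g δ) :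
    keepProj C Q p 𝒳 g q (DFinsupp.single δ v) = DFinsupp.single δ v := by
  classical
  simp [keepProj, h]

lemma keepProj_boundary (g : Version) (q : ℕ) :
    keepProj C Q p 𝒳 g q ∘ₗ boundary C Q p q ∘ₗ keepProj C Q p 𝒳 g (q + 1) =
      keepProj C Q p 𝒳 g q ∘ₗ boundary C Q p q := by
  refine DFinsupp.lhom_ext fun δ v => ?_
  by_cases h : Keep C 𝒳 g δ
  · simp only [LinearMap.comp_apply, keepProj_single_of_keep g δ v h]
  · simp only [LinearMap.comp_apply, keepProj_single g δ v h, map_zero]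
    simp only [boundary, LinearMap.sum_apply, LinearMap.smul_apply, faceChain_single, map_sum,
      map_smul]
    refine (Finset.sum_eq_zero fun j _ => ?_).symm
    rw [keepProj_single, smul_zero]
    simp only [Keep, not_or, not_not] at h ⊢
    exact ⟨h.1, (δ.range_face_subset j).trans h.2⟩

lemma bdry_bdry (g : Version) (q : ℕ) (ξ : Chain C Q p (q + 2)) :
    bdry C Q p 𝒳 g q (bdry C Q p 𝒳 g (q + 1) ξ) = 0 := by
  have h1 := LinearMap.congr_fun (keepProj_boundary (C := C) (Q := Q) (p := p) (𝒳 := 𝒳) g q)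
    (boundary C Q p (q + 1) ξ)
  have h2 := LinearMap.congr_fun (boundary_boundary C Q p q) ξ
  simp only [LinearMap.comp_apply, LinearMap.zero_apply] at h1 h2
  simp only [bdry, LinearMap.comp_apply, h1, h2, map_zero]

variable (C Q p)

/-- The chains all of whose constituting simplices belong to `s`. -/
def supportedOn {q : ℕ} (s : Set (Simplex C q)) : Submodule Q (Chain C Q p q) where
  carrier := {ξ | ∀ δ, ξ δ ≠ 0 → δ ∈ s}
  zero_mem' := fun δ h => absurd rfl h
  add_mem' := by
    intro a b ha hb δ h
    by_cases h0 : a δ = 0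
    · refine hb δ fun h1 => h ?_
      rw [DFinsupp.add_apply, h0, h1, add_zero]
    · exact ha δ h0
  smul_mem' := by
    intro c a ha δ h
    refine ha δ fun h1 => h ?_
    rw [DFinsupp.smul_apply, h1, smul_zero]

variable (pv : 𝒳.Perversity)

/-- The chains of the given version all of whose constituting simplices are allowable. -/
def allowableChains (g : Version) (q : ℕ) : Submodule Q (Chain C Q p q) :=
  supportedOn C Q p {δ | Keep C 𝒳 g δ ∧ δ.Allowable pv}

/-- Intersection chains: the simplices constituting the chain and those constituting its boundary
are allowable. -/
def intersectionChains (g : Version) : (q : ℕ) → Submodule Q (Chain C Q p q)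
  | 0 => allowableChains C Q p pv g 0
  | q + 1 => allowableChains C Q p pv g (q + 1) ⊓
      (allowableChains C Q p pv g q).comap (bdry C Q p 𝒳 g q)

variable {C Q p pv}

lemma bdry_mem (g : Version) (q : ℕ) :
    ∀ ξ ∈ intersectionChains C Q p pv g (q + 1),
      bdry C Q p 𝒳 g q ξ ∈ intersectionChains C Q p pv g q := by
  intro ξ hξ
  cases q with
  | zero => exact hξ.2
  | succ q =>
    refine ⟨hξ.2, ?_⟩
    change bdry C Q p 𝒳 g q (bdry C Q p 𝒳 g (q + 1) ξ) ∈ allowableChains C Q p pv g q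
    rw [bdry_bdry]
    exact Submodule.zero_mem _

variable (C Q p pv)

/-- The boundary map of intersection chains. -/
def intersectionBdry (g : Version) (q : ℕ) :
    intersectionChains C Q p pv g (q + 1) →ₗ[Q] intersectionChains C Q p pv g q :=
  (bdry C Q p 𝒳 g q).restrict (bdry_mem g q)

lemma intersectionBdry_comp (g : Version) (q : ℕ) :
    intersectionBdry C Q p pv g q ∘ₗ intersectionBdry C Q p pv g (q + 1) = 0 := by
  ext1 ξ
  exact Subtype.ext (bdry_bdry g q ξ.1)

/-- The intersection chains of an open set `V`, as a submodule of the intersection chains of the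
whole space: those whose simplices have image in `V`. (The strata of `V` are the components of the
intersections of `V` with the strata of the space, with the same formal dimensions and perversities,
so a simplex in `V` is allowable in `V` exactly if it is allowable in the whole space.) -/
def intersectionChainsIn (g : Version) (q : ℕ) (V : Set X) :
    Submodule Q (intersectionChains C Q p pv g q) :=
  (supportedOn C Q p {δ : Simplex C q | Set.range δ.toMap ⊆ V}).comap
    (intersectionChains C Q p pv g q).subtype

variable {C Q p}

lemma supportedOn_mono {q : ℕ} {s t : Set (Simplex C q)} (h : s ⊆ t) :
    supportedOn C Q p s ≤ supportedOn C Q p t := fun _ hξ δ hδ => h (hξ δ hδ)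

lemma single_mem_supportedOn {q : ℕ} {s : Set (Simplex C q)} {δ : Simplex C q} (h : δ ∈ s)
    (v : C.MultiTangent Q p δ.cell) :
    (DFinsupp.single δ v : Chain C Q p q) ∈ supportedOn C Q p s := by
  intro δ' h'
  by_cases he : δ = δ'
  · exact he ▸ h
  · exact absurd (DFinsupp.single_eq_of_ne (Ne.symm he)) h'

lemma boundary_supportedOn {q : ℕ} (V : Set X) :
    ∀ ξ ∈ supportedOn C Q p {δ : Simplex C (q + 1) | Set.range δ.toMap ⊆ V},
      boundary C Q p q ξ ∈ supportedOn C Q p {δ : Simplex C q | Set.range δ.toMap ⊆ V} := by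
  classical
  intro ξ hξ
  rw [← DFinsupp.sum_single (f := ξ), DFinsupp.sum, map_sum]
  refine Submodule.sum_mem _ fun δ hδ => ?_
  rw [boundary, LinearMap.sum_apply]
  refine Submodule.sum_mem _ fun j _ => ?_
  rw [LinearMap.smul_apply, faceChain_single]
  refine Submodule.smul_mem _ _ (single_mem_supportedOn ?_ _)
  exact (δ.range_face_subset j).trans (hξ δ (DFinsupp.mem_support_iff.1 hδ))

lemma keepProj_supportedOn (g : Version) {q : ℕ} (s : Set (Simplex C q)) :
    ∀ ξ ∈ supportedOn C Q p s, keepProj C Q p 𝒳 g q ξ ∈ supportedOn C Q p s := by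
  classical
  intro ξ hξ δ hδ
  refine hξ δ fun h => hδ ?_
  simp [keepProj, DFinsupp.filter_apply, h]

variable {pv}

lemma intersectionBdry_mem (g : Version) (q : ℕ) (V : Set X) :
    intersectionChainsIn C Q p pv g (q + 1) V ≤
      (intersectionChainsIn C Q p pv g q V).comap (intersectionBdry C Q p pv g q) :=
  fun ξ hξ => keepProj_supportedOn g _ _ (boundary_supportedOn V ξ.1 hξ)

lemma intersectionChainsIn_mono (g : Version) (q : ℕ) {V W : Set X} (h : V ⊆ W) :
    intersectionChainsIn C Q p pv g q V ≤ intersectionChainsIn C Q p pv g q W :=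
  Submodule.comap_mono (supportedOn_mono fun _ hδ => Set.Subset.trans hδ h)

end Chains

/-! ### Compactly supported sections -/

open CategoryTheory TopologicalSpace Opposite

section Sections

variable {X : Type u} [TopologicalSpace X] (Q : Subring ℝ)

instance : Limits.PreservesFilteredColimitsOfSize.{u, u} (forget (ModuleCat.{u} Q)) :=
  ⟨fun J _ _ => inferInstanceAs (Limits.PreservesColimitsOfShape J
    (forget₂ (ModuleCat.{u} Q) AddCommGrpCat ⋙ forget AddCommGrpCat))⟩

variable {Q}

/-- Sheaves of `Q`-modules on `X`. -/
abbrev ModSheaf (X : Type u) [TopologicalSpace X] (Q : Subring ℝ) :=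
  Sheaf (Opens.grothendieckTopology X) (ModuleCat.{u} Q)

/-- The support of a global section: the points near which the section does not vanish, i.e. at
which its germ is non-zero. -/
def sectionSupport (F : ModSheaf X Q) (s : F.obj.obj (op ⊤)) : Set X :=
  {x | ∀ U : Opens X, x ∈ U → F.obj.map (homOfLE (le_top : U ≤ ⊤)).op s ≠ 0}

lemma isClosed_sectionSupport (F : ModSheaf X Q) (s : F.obj.obj (op ⊤)) :
    IsClosed (sectionSupport F s) := by
  rw [← isOpen_compl_iff, isOpen_iff_mem_nhds]
  intro x hx
  simp only [sectionSupport, Set.mem_compl_iff, Set.mem_ofPred_eq, not_forall, not_not] at hx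
  obtain ⟨U, hxU, hU⟩ := hx
  filter_upwards [U.isOpen.mem_nhds hxU] with y hy h
  exact h U hy hU

lemma sectionSupport_add (F : ModSheaf X Q) (s t : F.obj.obj (op ⊤)) :
    sectionSupport F (s + t) ⊆ sectionSupport F s ∪ sectionSupport F t := by
  intro x hx
  by_contra h
  simp only [sectionSupport, Set.mem_union, Set.mem_ofPred_eq, not_or, not_forall, not_not] at h
  obtain ⟨⟨U, hxU, hU⟩, V, hxV, hV⟩ := h
  refine hx (U ⊓ V) ⟨hxU, hxV⟩ ?_
  have h1 : F.obj.map (homOfLE (le_top : U ⊓ V ≤ ⊤)).op s = 0 := by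
    have : (homOfLE (le_top : U ⊓ V ≤ ⊤)).op =
      (homOfLE (le_top : U ≤ ⊤)).op ≫ (homOfLE (inf_le_left : U ⊓ V ≤ U)).op := rfl
    rw [this, F.obj.map_comp, ModuleCat.comp_apply, hU, map_zero]
  have h2 : F.obj.map (homOfLE (le_top : U ⊓ V ≤ ⊤)).op t = 0 := by
    have : (homOfLE (le_top : U ⊓ V ≤ ⊤)).op =
      (homOfLE (le_top : V ≤ ⊤)).op ≫ (homOfLE (inf_le_right : U ⊓ V ≤ V)).op := rfl
    rw [this, F.obj.map_comp, ModuleCat.comp_apply, hV, map_zero]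
  rw [map_add, h1, h2, add_zero]

lemma sectionSupport_smul (F : ModSheaf X Q) (a : Q) (s : F.obj.obj (op ⊤)) :
    sectionSupport F (a • s) ⊆ sectionSupport F s := by
  intro x hx U hU h
  exact hx U hU (by rw [map_smul, h, smul_zero])

lemma sectionSupport_map {F G : ModSheaf X Q} (f : F ⟶ G) (s : F.obj.obj (op ⊤)) :
    sectionSupport G (f.hom.app (op ⊤) s) ⊆ sectionSupport F s := by
  intro x hx U hU h
  refine hx U hU ?_
  rw [← ModuleCat.comp_apply, ← f.hom.naturality, ModuleCat.comp_apply, h, map_zero]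

/-- The global sections with compact support. -/
def compactSections (F : ModSheaf X Q) : Submodule Q (F.obj.obj (op ⊤)) where
  carrier := {s | IsCompact (sectionSupport F s)}
  zero_mem' := by
    have : sectionSupport F 0 = ∅ := by
      ext x
      simp only [sectionSupport, Set.mem_ofPred_eq, Set.mem_empty_iff_false, iff_false, not_forall,
        not_not]
      exact ⟨⊤, trivial, map_zero _⟩
    rw [Set.mem_ofPred_eq, this]
    exact isCompact_empty
  add_mem' := fun {s t} hs ht =>
    (hs.union ht).of_isClosed_subset (isClosed_sectionSupport F _) (sectionSupport_add F s t)
  smul_mem' := fun a s hs =>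
    hs.of_isClosed_subset (isClosed_sectionSupport F _) (sectionSupport_smul F a s)

/-- The functor of compactly supported global sections. -/
def gammaC (X : Type u) [TopologicalSpace X] (Q : Subring ℝ) :
    ModSheaf X Q ⥤ ModuleCat.{u} Q where
  obj F := ModuleCat.of Q (compactSections F)
  map {F G} f := ModuleCat.ofHom ((f.hom.app (op ⊤)).hom.restrict fun s hs =>
    hs.of_isClosed_subset (isClosed_sectionSupport G _) (sectionSupport_map f s))

instance : (gammaC X Q).Additive where

end Sections

/-! ### Presheaves of quotients -/

section Quotients

variable {X : Type u} [TopologicalSpace X] {Q : Subring ℝ} {M M' M'' : Type u}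
  [AddCommGroup M] [Module Q M] [AddCommGroup M'] [Module Q M'] [AddCommGroup M''] [Module Q M'']

/-- The presheaf of quotients `U ↦ M / N U` for an order reversing family `N` of submodules. Its
restriction maps are the quotient maps. -/
def quotPresheaf (N : Opens X → Submodule Q M) (hN : Antitone N) :
    (Opens X)ᵒᵖ ⥤ ModuleCat.{u} Q where
  obj U := ModuleCat.of Q (M ⧸ N U.unop)
  map f := ModuleCat.ofHom (Submodule.mapQ _ _ LinearMap.id (hN f.unop.le))
  map_id U := by
    ext : 1
    exact Submodule.linearMap_qext _ rfl
  map_comp f h := by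
    ext : 1
    exact Submodule.linearMap_qext _ rfl

/-- The morphism of presheaves of quotients induced by a linear map. -/
def quotPresheafMap (N : Opens X → Submodule Q M) (hN : Antitone N)
    (N' : Opens X → Submodule Q M') (hN' : Antitone N') (d : M →ₗ[Q] M')
    (hd : ∀ U, N U ≤ (N' U).comap d) : quotPresheaf N hN ⟶ quotPresheaf N' hN' where
  app U := ModuleCat.ofHom (Submodule.mapQ _ _ d (hd U.unop))
  naturality U V f := by
    ext : 1
    exact Submodule.linearMap_qext _ rfl

lemma quotPresheafMap_comp (N : Opens X → Submodule Q M) (hN : Antitone N)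
    (N' : Opens X → Submodule Q M') (hN' : Antitone N') (N'' : Opens X → Submodule Q M'')
    (hN'' : Antitone N'') (d : M →ₗ[Q] M') (d' : M' →ₗ[Q] M'')
    (hd : ∀ U, N U ≤ (N' U).comap d) (hd' : ∀ U, N' U ≤ (N'' U).comap d') (h : d' ∘ₗ d = 0) :
    quotPresheafMap N hN N' hN' d hd ≫ quotPresheafMap N' hN' N'' hN'' d' hd' = 0 := by
  ext U : 3
  refine Submodule.linearMap_qext _ ?_
  ext1 ξ
  change Submodule.Quotient.mk ((d' ∘ₗ d) ξ) = _
  rw [h]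
  rfl

end Quotients

/-! ### The intersection chain complex and the intersection chain sheaf -/

section Complexes

variable {X : Type u} [TopologicalSpace X] {𝒜 : RationalPolyhedralAtlas X}
  (C : OpenFaceStructure 𝒜) (Q : Subring ℝ) (p : ℕ) {𝒳 : Filtration X} (pv : 𝒳.Perversity)
  (g : Version)

/-- The complex of tropical intersection `(p, •)`-chains. -/
def intersectionComplex : ChainComplex (ModuleCat.{u} Q) ℕ :=
  ChainComplex.of (fun q => ModuleCat.of Q (intersectionChains C Q p pv g q))
    (fun q => ModuleCat.ofHom (intersectionBdry C Q p pv g q)) fun q => by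
      rw [← ModuleCat.ofHom_comp, intersectionBdry_comp]
      rfl

/-- The presheaf sending `U` to the relative intersection chains of degree `q` of the space modulo
the complement of the closure of `U`. -/
def chainPresheaf (q : ℕ) : (Opens X)ᵒᵖ ⥤ ModuleCat.{u} Q :=
  quotPresheaf (fun U : Opens X => intersectionChainsIn C Q p pv g q (closure (U : Set X))ᶜ)
    fun _ _ h => intersectionChainsIn_mono g q (Set.compl_subset_compl.2 (closure_mono h))

/-- The boundary map of relative intersection chains, as a morphism of presheaves. -/
def chainPresheafBdry (q : ℕ) :
    chainPresheaf C Q p pv g (q + 1) ⟶ chainPresheaf C Q p pv g q :=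
  quotPresheafMap _ _ _ _ (intersectionBdry C Q p pv g q) fun _ => intersectionBdry_mem g q _

/-- The complex of presheaves of relative intersection chains. -/
def chainPresheafComplex : ChainComplex ((Opens X)ᵒᵖ ⥤ ModuleCat.{u} Q) ℕ :=
  ChainComplex.of (chainPresheaf C Q p pv g) (chainPresheafBdry C Q p pv g) fun q =>
    quotPresheafMap_comp _ _ _ _ _ _ _ _ _ _ (intersectionBdry_comp C Q p pv g q)

/-- The singular tropical intersection chain sheaf: the sheafification of the complex of presheaves
of relative intersection chains. Its term in homological degree `q` is the sheaf usually placed in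
cohomological degree `-q`. -/
def chainSheafComplex : ChainComplex (ModSheaf X Q) ℕ :=
  ((presheafToSheaf (Opens.grothendieckTopology X) (ModuleCat.{u} Q)).mapHomologicalComplex
    _).obj (chainPresheafComplex C Q p pv g)

/-- The complex of compactly supported global sections of the intersection chain sheaf. -/
def compactSectionsComplex : ChainComplex (ModuleCat.{u} Q) ℕ :=
  ((gammaC X Q).mapHomologicalComplex _).obj (chainSheafComplex C Q p pv g)

/-- A compactly supported section, as a global section of the intersection chain sheaf. -/
def toGlobalSection (q : ℕ) : (compactSectionsComplex C Q p pv g).X q →ₗ[Q]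
    ((chainSheafComplex C Q p pv g).X q).obj.obj (op ⊤) :=
  (compactSections ((chainSheafComplex C Q p pv g).X q)).subtype

/-- The global section of the intersection chain sheaf defined by an intersection chain. -/
def chainSection (q : ℕ) : (intersectionComplex C Q p pv g).X q →ₗ[Q]
    ((chainSheafComplex C Q p pv g).X q).obj.obj (op ⊤) :=
  ((toSheafify (Opens.grothendieckTopology X) (chainPresheaf C Q p pv g q)).app (op ⊤)).hom ∘ₗ
    (Submodule.mkQ (intersectionChainsIn C Q p pv g q (closure ((⊤ : Opens X) : Set X))ᶜ))

end Complexes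

end

end TropIH

/-! All the presheaf sections are quotients of one module, the intersection chains of the whole
space. The germ of a chain at a point `x` vanishes exactly when all its simplices miss `x`. Indeed,
the union of the images of its finitely many simplices is compact, hence closed, so in a regular
Hausdorff space a chain missing `x` misses a closed neighbourhood of `x`
(`exists_mem_intersectionChainsIn`). The germ at `x` thus records precisely the coefficients of the
simplices through `x`. Consequently the section of a chain is supported on the union of the images
of its simplices, which is compact, and the chain is recovered by reading each coefficient at any
point of the simplex.

Conversely, let `s` be a compactly supported section. Near each point it is represented by an
intersection chain. Along a fixed simplex `δ`, the coefficient of `δ` in the representing chains is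
locally constant, hence constant because the standard simplex is connected (`exists_coefficient`).
If this coefficient is non-zero, the image of `δ` lies in the support of `s`; finitely many
representing chains serve the whole support, so only finitely many `δ` occur. The chain with these
coefficients has the same germs as `s`. It is an intersection chain because this is a local
condition (`mem_intersectionChains_of_locally`): allowability concerns one simplex at a time, and
the boundary of a chain missing `x` misses `x`. Whole simplices are compared throughout, so no
subdivision enters.

Compatibility with the boundary maps is naturality of the map from a presheaf to its sheafification.
The GM and non-GM versions are treated alike, since dropping faces creates no new simplices. -/

open scoped Topology
open CategoryTheory TopologicalSpace Opposite
open TropIH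

namespace TropIH

universe u

/-! ### Sheafification of a presheaf of quotients of a fixed module -/

section QuotientSheaf

variable {X : Type u} [TopologicalSpace X] {Q : Subring ℝ} {M : Type u}
  [AddCommGroup M] [Module Q M] (N : Opens X → Submodule Q M) (hN : Antitone N)

/-- The sheaf associated to a presheaf of quotients. -/
noncomputable abbrev quotSheaf : ModSheaf X Q :=
  (presheafToSheaf (Opens.grothendieckTopology X) (ModuleCat.{u} Q)).obj (quotPresheaf N hN)

/-- The section over `U` of the sheaf of quotients defined by an element of the module. -/
noncomputable def quotSection (U : Opens X) : M →ₗ[Q] (quotSheaf N hN).obj.obj (op U) :=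
  ((toSheafify (Opens.grothendieckTopology X) (quotPresheaf N hN)).app (op U)).hom ∘ₗ
    (N U).mkQ

variable {N hN}

lemma quotSection_map {U V : Opens X} (h : V ≤ U) (ξ : M) :
    (quotSheaf N hN).obj.map (homOfLE h).op (quotSection N hN U ξ) = quotSection N hN V ξ := by
  have := (toSheafify (Opens.grothendieckTopology X) (quotPresheaf N hN)).naturality
    (homOfLE h).op
  exact (ConcreteCategory.congr_hom this ((N U).mkQ ξ)).symm

lemma quotSection_eq_zero_of_mem {U : Opens X} {ξ : M} (h : ξ ∈ N U) :
    quotSection N hN U ξ = 0 := by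
  change (toSheafify _ (quotPresheaf N hN)).app (op U) ((N U).mkQ ξ) = 0
  rw [show (N U).mkQ ξ = 0 from (Submodule.Quotient.mk_eq_zero _).2 h]
  exact map_zero ((toSheafify _ (quotPresheaf N hN)).app (op U)).hom

/-- The map to the sheafification is only locally injective, which is why `U` has to be shrunk
around `x`. -/
lemma exists_mem_of_quotSection_eq_zero {U : Opens X} {ξ : M} (h : quotSection N hN U ξ = 0)
    {x : X} (hx : x ∈ U) : ∃ V ≤ U, x ∈ V ∧ ξ ∈ N V := by
  -- The opens on which the class of `ξ` and `0` already agree in the presheaf form a covering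
  -- sieve.
  obtain ⟨V, f, hf, hxV⟩ := Presheaf.equalizerSieve_mem (Opens.grothendieckTopology X)
    (toSheafify (Opens.grothendieckTopology X) (quotPresheaf N hN)) (X := op U)
    ((N U).mkQ ξ) 0 (by rw [map_zero]; exact h) x hx
  refine ⟨V, f.le, hxV, ?_⟩
  have hf : (quotPresheaf N hN).map f.op ((N U).mkQ ξ) = (quotPresheaf N hN).map f.op 0 := hf
  rw [map_zero] at hf
  exact (Submodule.Quotient.mk_eq_zero _).1 hf

/-- The map to the sheafification is locally surjective, and a local presheaf section is a class of
some element of `M`. A section of the sheaf is therefore locally given by an element of the global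
module. -/
lemma exists_quotSection_eq {U : Opens X} (s : (quotSheaf N hN).obj.obj (op U)) {x : X}
    (hx : x ∈ U) : ∃ (V : Opens X) (h : V ≤ U), x ∈ V ∧
      ∃ ξ : M, (quotSheaf N hN).obj.map (homOfLE h).op s = quotSection N hN V ξ := by
  obtain ⟨V, f, ⟨t, ht⟩, hxV⟩ := Presheaf.imageSieve_mem (Opens.grothendieckTopology X)
    (toSheafify (Opens.grothendieckTopology X) (quotPresheaf N hN)) (U := op U) s x hx
  obtain ⟨ξ, rfl⟩ := Submodule.mkQ_surjective _ t
  exact ⟨V, f.le, hxV, ξ, ht.symm⟩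

end QuotientSheaf

/-- A sheaf is separated; this is applied to the sieve of all opens on which the two sections agree,
which covers `U` by hypothesis. -/
lemma ModSheaf.eq_of_locally_eq {X : Type u} [TopologicalSpace X] {Q : Subring ℝ}
    (F : ModSheaf X Q) {U : Opens X} {s t : F.obj.obj (op U)}
    (h : ∀ x ∈ U, ∃ (V : Opens X) (hV : V ≤ U), x ∈ V ∧
      F.obj.map (homOfLE hV).op s = F.obj.map (homOfLE hV).op t) : s = t := by
  let S : Sieve U :=
    { arrows := fun V f => F.obj.map f.op s = F.obj.map f.op t
      downward_closed := by
        intro V W f hf k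
        rw [op_comp, F.obj.map_comp, ModuleCat.comp_apply, ModuleCat.comp_apply, hf] }
  refine F.isSeparated U S (fun x hx => ?_) s t fun V f hf => hf
  obtain ⟨V, hV, hxV, he⟩ := h x hx
  exact ⟨V, homOfLE hV, he, hxV⟩

/-! ### Chains near a point: coefficients of the simplices through it -/

section Coefficients

variable {X : Type u} [TopologicalSpace X] {𝒜 : RationalPolyhedralAtlas X}
  {C : OpenFaceStructure 𝒜} {Q : Subring ℝ} {p : ℕ} {𝒳 : Filtration X} {pv : 𝒳.Perversity}
  {g : Version} {q : ℕ}

/-- Provides a point at which the coefficient of the simplex can be read off. -/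
lemma Simplex.range_nonempty (δ : Simplex C q) : (Set.range δ.toMap).Nonempty := by
  obtain ⟨x, -⟩ := exists_support (Finset.univ : Finset (Fin (q + 1))) Finset.univ_nonempty
  exact ⟨_, x, rfl⟩

/-- Convexity gives connectedness, which later makes the coefficient of a simplex in a section
independent of the point where it is read. -/
instance (q : ℕ) : PreconnectedSpace (Δ q) :=
  Subtype.preconnectedSpace (convex_stdSimplex ℝ _).isPreconnected

/-- The chains whose simplices all avoid the point `x`. -/
def avoiding (C : OpenFaceStructure 𝒜) (Q : Subring ℝ) (p q : ℕ) (x : X) :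
    Submodule Q (Chain C Q p q) :=
  supportedOn C Q p {δ : Simplex C q | Set.range δ.toMap ⊆ {x}ᶜ}

/-- This is the description of germs: working modulo `avoiding` at `x` means comparing coefficients
of the simplices through `x`. -/
lemma sub_mem_avoiding_iff {ξ η : Chain C Q p q} {x : X} :
    ξ - η ∈ avoiding C Q p q x ↔ ∀ δ : Simplex C q, x ∈ Set.range δ.toMap → ξ δ = η δ := by
  have : ∀ δ : Simplex C q, Set.range δ.toMap ⊆ {x}ᶜ ↔ x ∉ Set.range δ.toMap := fun δ =>
    Set.subset_compl_singleton_iff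
  refine forall_congr' fun δ => ?_
  rw [Set.mem_ofPred_eq, this, DFinsupp.sub_apply, ne_eq, sub_eq_zero, not_imp_not]

/-- Faces of a simplex missing `x` miss `x`, and dropping some of them does no harm. Hence the germ
of the boundary at `x` depends only on the germ of the chain at `x`. -/
lemma bdry_mem_avoiding {ξ : Chain C Q p (q + 1)} {x : X} (h : ξ ∈ avoiding C Q p (q + 1) x) :
    bdry C Q p 𝒳 g q ξ ∈ avoiding C Q p q x :=
  keepProj_supportedOn g _ _ (boundary_supportedOn _ ξ h)

/-- Being an intersection chain is a local condition. -/
lemma mem_intersectionChains_of_locally {ξ : Chain C Q p q}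
    (h : ∀ x : X, ∃ η ∈ intersectionChains C Q p pv g q, ξ - η ∈ avoiding C Q p q x) :
    ξ ∈ intersectionChains C Q p pv g q := by
  -- Whether a simplex is allowed to occur is decided at a single point of its image, where its
  -- coefficient agrees with that in some allowable chain. The degree is left free because the claim
  -- serves both the chain and its boundary.
  have key : ∀ {q : ℕ} {ξ : Chain C Q p q}, (∀ x : X, ∃ η ∈ allowableChains C Q p pv g q,
      ξ - η ∈ avoiding C Q p q x) → ξ ∈ allowableChains C Q p pv g q := by
    intro q ξ h δ hδ
    obtain ⟨x, hx⟩ := δ.range_nonempty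
    obtain ⟨η, hη, hd⟩ := h x
    exact hη δ (by rwa [← sub_mem_avoiding_iff.1 hd δ hx])
  cases q with
  | zero => exact key h
  | succ q =>
    refine ⟨key fun x => ?_, key fun x => ?_⟩
    · obtain ⟨η, hη, hd⟩ := h x
      exact ⟨η, hη.1, hd⟩
    · obtain ⟨η, hη, hd⟩ := h x
      -- The local comparison chain for the boundary of `ξ` is the boundary of `η`.
      exact ⟨_, hη.2, by rw [← map_sub]; exact bdry_mem_avoiding hd⟩

/-- The union of the images of the simplices of a chain. -/
def carrier (ξ : Chain C Q p q) : Set X := ⋃ δ ∈ {δ | ξ δ ≠ 0}, Set.range δ.toMap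

lemma finite_ne_zero (ξ : Chain C Q p q) : {δ | ξ δ ≠ 0}.Finite := by
  classical
  refine ξ.support.finite_toSet.subset fun δ hδ => ?_
  exact DFinsupp.mem_support_iff.2 hδ

lemma isCompact_carrier (ξ : Chain C Q p q) : IsCompact (carrier ξ) :=
  (finite_ne_zero ξ).isCompact_biUnion fun δ _ => isCompact_range δ.toMap.continuous

lemma mem_avoiding_iff {ξ : Chain C Q p q} {x : X} :
    ξ ∈ avoiding C Q p q x ↔ x ∉ carrier ξ := by
  simp only [avoiding, carrier, Set.mem_iUnion, not_exists]
  exact forall_congr' fun _ => forall_congr' fun _ => Set.subset_compl_singleton_iff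

lemma mem_intersectionChainsIn_of_carrier_subset {ξ : intersectionChains C Q p pv g q} {V : Set X}
    (h : carrier ξ.1 ⊆ V) : ξ ∈ intersectionChainsIn C Q p pv g q V :=
  fun _ hδ => (Set.subset_biUnion_of_mem (u := fun δ : Simplex C q => Set.range δ.toMap)
    hδ).trans h

/-- A chain that is zero in the quotient over `U` misses even the closure of `U`, in particular each
point of `U`. The next lemma is the converse near a point. -/
lemma avoiding_of_mem_intersectionChainsIn {ξ : intersectionChains C Q p pv g q} {U : Opens X}
    (h : ξ ∈ intersectionChainsIn C Q p pv g q (closure (U : Set X))ᶜ) {x : X} (hx : x ∈ U) :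
    ξ.1 ∈ avoiding C Q p q x := by
  intro δ hδ
  refine (h δ hδ).trans (Set.compl_subset_compl.2 ?_)
  exact Set.singleton_subset_iff.2 (subset_closure hx)

/-- The carrier is compact, hence closed in a Hausdorff space, and regularity separates `x` from it
by a closed neighbourhood. Both the finiteness of chains and the separation axioms enter here. -/
lemma exists_mem_intersectionChainsIn [T2Space X] [RegularSpace X]
    {ξ : intersectionChains C Q p pv g q} {x : X} (h : ξ.1 ∈ avoiding C Q p q x) :
    ∃ U : Opens X, x ∈ U ∧ ξ ∈ intersectionChainsIn C Q p pv g q (closure (U : Set X))ᶜ := by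
  have hc : (carrier ξ.1)ᶜ ∈ 𝓝 x :=
    (isCompact_carrier ξ.1).isClosed.isOpen_compl.mem_nhds (mem_avoiding_iff.1 h)
  obtain ⟨K, hK, hKc, hKs⟩ := exists_mem_nhds_isClosed_subset hc
  -- Closedness of `K` matters: the chain must miss the closure of the chosen open set, and the
  -- closure of the interior of `K` stays in `K`.
  refine ⟨⟨interior K, isOpen_interior⟩, mem_interior_iff_mem_nhds.2 hK,
    mem_intersectionChainsIn_of_carrier_subset ?_⟩
  exact Set.subset_compl_comm.1 ((closure_minimal interior_subset hKc).trans hKs)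

end Coefficients

/-! ### Sections of the intersection chain sheaf and the chains representing them -/

section Sections

variable {X : Type u} [TopologicalSpace X] {𝒜 : RationalPolyhedralAtlas X}
  (C : OpenFaceStructure 𝒜) (Q : Subring ℝ) (p : ℕ) {𝒳 : Filtration X} (pv : 𝒳.Perversity)
  (g : Version) (q : ℕ)

/-- The sheaf associated to the presheaf of relative intersection chains. -/
noncomputable abbrev chainSheaf : ModSheaf X Q :=
  quotSheaf (fun U : Opens X => intersectionChainsIn C Q p pv g q (closure (U : Set X))ᶜ)
    fun _ _ h => intersectionChainsIn_mono g q (Set.compl_subset_compl.2 (closure_mono h))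

/-- The section over `U` of the intersection chain sheaf defined by an intersection chain. -/
noncomputable def localSection (U : Opens X) :
    intersectionChains C Q p pv g q →ₗ[Q] (chainSheaf C Q p pv g q).obj.obj (op U) :=
  quotSection _ _ U

variable {C Q p pv g q}

lemma avoiding_of_localSection_eq_zero {U : Opens X} {ξ : intersectionChains C Q p pv g q}
    (h : localSection C Q p pv g q U ξ = 0) {x : X} (hx : x ∈ U) :
    ξ.1 ∈ avoiding C Q p q x := by
  obtain ⟨V, -, hxV, hV⟩ := exists_mem_of_quotSection_eq_zero h hx
  exact avoiding_of_mem_intersectionChainsIn hV hxV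

lemma exists_localSection_eq_zero [T2Space X] [RegularSpace X]
    {ξ : intersectionChains C Q p pv g q} {x : X}
    (h : ξ.1 ∈ avoiding C Q p q x) :
    ∃ U : Opens X, x ∈ U ∧ localSection C Q p pv g q U ξ = 0 := by
  obtain ⟨U, hxU, hU⟩ := exists_mem_intersectionChainsIn h
  exact ⟨U, hxU, quotSection_eq_zero_of_mem hU⟩

lemma localSection_map {U V : Opens X} (h : V ≤ U) (ξ : intersectionChains C Q p pv g q) :
    (chainSheaf C Q p pv g q).obj.map (homOfLE h).op (localSection C Q p pv g q U ξ) =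
      localSection C Q p pv g q V ξ :=
  quotSection_map h ξ

/-- The support of the section defined by an intersection chain is the union of the images of its
simplices. -/
lemma sectionSupport_localSection [T2Space X] [RegularSpace X]
    (ξ : intersectionChains C Q p pv g q) :
    sectionSupport (chainSheaf C Q p pv g q) (localSection C Q p pv g q ⊤ ξ) = carrier ξ.1 := by
  ext x
  rw [← not_iff_not, ← mem_avoiding_iff]
  simp only [sectionSupport, Set.mem_ofPred_eq, not_forall, not_not, localSection_map]
  constructor
  · rintro ⟨U, hxU, hU⟩
    exact avoiding_of_localSection_eq_zero hU hxU
  · intro h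
    obtain ⟨U, hxU, hU⟩ := exists_localSection_eq_zero h
    exact ⟨U, hxU, hU⟩

/-- If the section vanishes, so does its germ at a point of each simplex, and this germ contains the
coefficient of the simplex. -/
lemma localSection_injective : Function.Injective (localSection C Q p pv g q ⊤) := by
  rw [← LinearMap.ker_eq_bot, LinearMap.ker_eq_bot']
  intro ξ h
  refine Subtype.ext (DFinsupp.ext fun δ => ?_)
  obtain ⟨x, hx⟩ := δ.range_nonempty
  by_contra hδ
  -- A simplex with non-zero coefficient would have to miss its own point `x`.
  exact avoiding_of_localSection_eq_zero h (Opens.mem_top x) δ hδ hx rfl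

/-- The chain `ξ` represents the section `s` near `x`. -/
def Represents (s : (chainSheaf C Q p pv g q).obj.obj (op ⊤)) (x : X)
    (ξ : intersectionChains C Q p pv g q) : Prop :=
  ∃ U : Opens X, x ∈ U ∧ (chainSheaf C Q p pv g q).obj.map (homOfLE (le_top : U ≤ ⊤)).op s =
    localSection C Q p pv g q U ξ

lemma map_eq_localSection_of_le {s : (chainSheaf C Q p pv g q).obj.obj (op ⊤)}
    {ξ : intersectionChains C Q p pv g q} {U V : Opens X} (hVU : V ≤ U)
    (h : (chainSheaf C Q p pv g q).obj.map (homOfLE (le_top : U ≤ ⊤)).op s =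
      localSection C Q p pv g q U ξ) :
    (chainSheaf C Q p pv g q).obj.map (homOfLE (le_top : V ≤ ⊤)).op s =
      localSection C Q p pv g q V ξ := by
  rw [← localSection_map hVU, ← h, ← ModuleCat.comp_apply, ← Functor.map_comp]
  rfl

/-- The representing chain is an intersection chain of the whole space; only its agreement with `s`
is local. -/
lemma exists_represents (s : (chainSheaf C Q p pv g q).obj.obj (op ⊤)) (x : X) :
    ∃ ξ, Represents s x ξ := by
  obtain ⟨V, _, hxV, ξ, hξ⟩ := exists_quotSection_eq s (Opens.mem_top x)
  exact ⟨ξ, V, hxV, hξ⟩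

/-- This openness drives both the local constancy of coefficients and the extraction of a finite
subcover of the support. -/
lemma Represents.eventually {s : (chainSheaf C Q p pv g q).obj.obj (op ⊤)} {x : X}
    {ξ : intersectionChains C Q p pv g q} (h : Represents s x ξ) :
    ∀ᶠ y in 𝓝 x, Represents s y ξ := by
  obtain ⟨U, hxU, hU⟩ := h
  filter_upwards [U.isOpen.mem_nhds hxU] with y hy
  exact ⟨U, hy, hU⟩

/-- By `sub_mem_avoiding_iff`, any two representatives at `x` have the same coefficients on the
simplices through `x`. -/
lemma Represents.sub_mem_avoiding {s : (chainSheaf C Q p pv g q).obj.obj (op ⊤)} {x : X}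
    {ξ η : intersectionChains C Q p pv g q} (hξ : Represents s x ξ) (hη : Represents s x η) :
    ξ.1 - η.1 ∈ avoiding C Q p q x := by
  obtain ⟨U, hxU, hU⟩ := hξ
  obtain ⟨V, hxV, hV⟩ := hη
  refine avoiding_of_localSection_eq_zero (U := U ⊓ V) (ξ := ξ - η) ?_ ⟨hxU, hxV⟩
  rw [map_sub, ← map_eq_localSection_of_le inf_le_left hU,
    ← map_eq_localSection_of_le inf_le_right hV, sub_self]

/-- A difference that misses `x` vanishes as a section near `x`. This lets the chain assembled from
coefficients replace the chosen local representatives. -/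
lemma Represents.of_sub_mem_avoiding [T2Space X] [RegularSpace X]
    {s : (chainSheaf C Q p pv g q).obj.obj (op ⊤)} {x : X} {ξ η : intersectionChains C Q p pv g q} (hη : Represents s x η)
    (h : ξ.1 - η.1 ∈ avoiding C Q p q x) : Represents s x ξ := by
  obtain ⟨U, hxU, hU⟩ := hη
  obtain ⟨V, hxV, hV⟩ := exists_localSection_eq_zero (ξ := ξ - η) h
  refine ⟨U ⊓ V, ⟨hxU, hxV⟩, ?_⟩
  rw [map_eq_localSection_of_le inf_le_left hU, eq_comm, ← sub_eq_zero, ← map_sub,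
    ← localSection_map (inf_le_right : U ⊓ V ≤ V), hV, map_zero]

lemma eq_localSection_of_represents {s : (chainSheaf C Q p pv g q).obj.obj (op ⊤)}
    {ξ : intersectionChains C Q p pv g q} (h : ∀ x, Represents s x ξ) :
    localSection C Q p pv g q ⊤ ξ = s := by
  refine ModSheaf.eq_of_locally_eq _ fun x _ => ?_
  obtain ⟨U, hxU, hU⟩ := h x
  exact ⟨U, le_top, hxU, by rw [hU, localSection_map]⟩

/-- The coefficient of a simplex in a section: the coefficient in any chain representing the
section near some point of the simplex. -/
lemma exists_coefficient (s : (chainSheaf C Q p pv g q).obj.obj (op ⊤)) (δ : Simplex C q) :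
    ∃ c : C.MultiTangent Q p δ.cell, ∀ x ∈ Set.range δ.toMap,
      ∀ ξ : intersectionChains C Q p pv g q, Represents s x ξ → ξ.1 δ = c := by
  choose ξ hξ using exists_represents s
  have hc : ∀ (x : X) (η : intersectionChains C Q p pv g q), x ∈ Set.range δ.toMap →
      Represents s x η → (ξ x).1 δ = η.1 δ := fun x η hx hη =>
    sub_mem_avoiding_iff.1 ((hξ x).sub_mem_avoiding hη) δ hx
  -- The chain chosen at the image of `a` still represents `s` at the image of any nearby `b`. Both
  -- points lie on `δ`, so it has there the same coefficient of `δ` as the chain chosen for `b`.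
  have hl : IsLocallyConstant fun a : Δ q => (ξ (δ.toMap a)).1 δ := by
    refine (IsLocallyConstant.iff_eventually_eq _).2 fun a => ?_
    filter_upwards [δ.toMap.continuous.continuousAt.eventually (hξ (δ.toMap a)).eventually]
      with b hb
    exact hc _ _ ⟨b, rfl⟩ hb
  obtain ⟨_, a, -⟩ := δ.range_nonempty
  refine ⟨(ξ (δ.toMap a)).1 δ, ?_⟩
  rintro _ ⟨b, rfl⟩ η hη
  rw [← hc _ η ⟨b, rfl⟩ hη]
  exact hl.apply_eq_of_preconnectedSpace b a

/-- Every compactly supported section is defined by an intersection chain. -/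
lemma exists_localSection_eq [T2Space X] [RegularSpace X]
    {s : (chainSheaf C Q p pv g q).obj.obj (op ⊤)}
    (hs : IsCompact (sectionSupport (chainSheaf C Q p pv g q) s)) :
    ∃ ξ, localSection C Q p pv g q ⊤ ξ = s := by
  classical
  choose c hc using exists_coefficient s
  choose ξ hξ using exists_represents s
  -- Compactness leaves finitely many chains that together represent `s` at all points of its
  -- support; every `δ` with `c δ ≠ 0` occurs in one of them.
  have hfin : {δ | c δ ≠ 0}.Finite := by
    obtain ⟨t, -, ht⟩ := hs.elim_nhds_subcover (fun x => {y | Represents s y (ξ x)})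
      fun x _ => (hξ x).eventually
    refine (t.finite_toSet.biUnion fun x _ => finite_ne_zero (ξ x).1).subset fun δ hδ => ?_
    obtain ⟨y, hy⟩ := δ.range_nonempty
    -- Outside the support the zero chain represents `s`, which would force `c δ = 0`.
    have hys : y ∈ sectionSupport (chainSheaf C Q p pv g q) s := by
      intro U hyU hU
      refine hδ (hc δ y hy 0 ⟨U, hyU, ?_⟩).symm
      rw [hU, map_zero]
    obtain ⟨x, hx, hxy⟩ := Set.mem_iUnion₂.1 (ht hys)
    refine Set.mem_iUnion₂.2 ⟨x, hx, ?_⟩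
    change (ξ x).1 δ ≠ 0
    rwa [hc δ y hy _ hxy]
  let η : Chain C Q p q := DFinsupp.mk hfin.toFinset fun δ => c δ
  have hη : ∀ δ, η δ = c δ := by
    intro δ
    by_cases h : c δ = 0
    · simp [η, DFinsupp.mk_apply, h]
    · simp [η, DFinsupp.mk_apply, h]
  -- By construction `η` has the same germ at each `x` as the representative chosen there. This
  -- yields first that `η` is an intersection chain and then that it represents `s` everywhere.
  have hd : ∀ x, η - (ξ x).1 ∈ avoiding C Q p q x := fun x =>
    sub_mem_avoiding_iff.2 fun δ hx => by rw [hη, hc δ x hx _ (hξ x)]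
  have hmem : η ∈ intersectionChains C Q p pv g q :=
    mem_intersectionChains_of_locally fun x => ⟨_, (ξ x).2, hd x⟩
  exact ⟨⟨η, hmem⟩, eq_localSection_of_represents fun x =>
    (hξ x).of_sub_mem_avoiding (ξ := ⟨η, hmem⟩) (hd x)⟩

end Sections

/-! ### The comparison isomorphism of complexes -/

section Comparison

variable {X : Type u} [TopologicalSpace X] {𝒜 : RationalPolyhedralAtlas X}
  (C : OpenFaceStructure 𝒜) (Q : Subring ℝ) (p : ℕ)
  {𝒳 : Filtration X} (pv : 𝒳.Perversity) (g : Version)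

/-- The boundary map of the sheaves of intersection chains. -/
noncomputable def chainSheafBdry (q : ℕ) :
    chainSheaf C Q p pv g (q + 1) ⟶ chainSheaf C Q p pv g q :=
  (presheafToSheaf (Opens.grothendieckTopology X) (ModuleCat.{u} Q)).map
    (chainPresheafBdry C Q p pv g q)

/-- Naturality of the map to the sheafification, evaluated on the class of `ξ`. -/
lemma chainSheafBdry_localSection (q : ℕ) (ξ : intersectionChains C Q p pv g (q + 1)) :
    (chainSheafBdry C Q p pv g q).hom.app (op ⊤) (localSection C Q p pv g (q + 1) ⊤ ξ) =
      localSection C Q p pv g q ⊤ (intersectionBdry C Q p pv g q ξ) := by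
  have := congrArg (fun f => f.app (op ⊤)) (toSheafify_naturality
    (Opens.grothendieckTopology X) (chainPresheafBdry C Q p pv g q))
  exact (ConcreteCategory.congr_hom this (Submodule.Quotient.mk ξ)).symm

lemma compactSectionsComplex_d (q : ℕ) : (compactSectionsComplex C Q p pv g).d (q + 1) q =
    (gammaC X Q).map (chainSheafBdry C Q p pv g q) := by
  -- Both functors act on the complex degree by degree, so only the differential of the underlying
  -- `ChainComplex.of` remains to be identified.
  change (gammaC X Q).map ((presheafToSheaf (Opens.grothendieckTopology X)
    (ModuleCat.{u} Q)).map ((chainPresheafComplex C Q p pv g).d (q + 1) q)) = _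
  exact congrArg _ (congrArg _ (ChainComplex.of_d _ _ q))

lemma intersectionComplex_d (q : ℕ) : (intersectionComplex C Q p pv g).d (q + 1) q =
    ModuleCat.ofHom (intersectionBdry C Q p pv g q) :=
  ChainComplex.of_d (fun q => ModuleCat.of Q (intersectionChains C Q p pv g q))
    (fun q => ModuleCat.ofHom (intersectionBdry C Q p pv g q)) q

variable [T2Space X] [RegularSpace X]

/-- The compactly supported section defined by an intersection chain. -/
noncomputable def compactSection (q : ℕ) :
    intersectionChains C Q p pv g q →ₗ[Q] compactSections (chainSheaf C Q p pv g q) :=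
  (localSection C Q p pv g q ⊤).codRestrict _ fun ξ => by
    change IsCompact _
    rw [sectionSupport_localSection]
    exact isCompact_carrier ξ.1

/-- Injectivity is inherited from global sections; surjectivity is where compactness of the support
makes the reconstructed chain finite. -/
lemma compactSection_bijective (q : ℕ) : Function.Bijective (compactSection C Q p pv g q) := by
  refine ⟨fun ξ η h => localSection_injective (congrArg Subtype.val h), fun s => ?_⟩
  obtain ⟨ξ, hξ⟩ := exists_localSection_eq s.2
  exact ⟨ξ, Subtype.ext hξ⟩

/-- The comparison map from intersection chains to compactly supported sections. -/
noncomputable def comparison :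
    intersectionComplex C Q p pv g ⟶ compactSectionsComplex C Q p pv g where
  f q := ModuleCat.ofHom (compactSection C Q p pv g q)
  comm' := by
    rintro _ q rfl
    rw [compactSectionsComplex_d, intersectionComplex_d]
    ext ξ
    exact Subtype.ext (chainSheafBdry_localSection C Q p pv g q ξ)

instance : IsIso (comparison C Q p pv g) := by
  have (q : ℕ) : IsIso ((comparison C Q p pv g).f q) :=
    (LinearEquiv.ofBijective _ (compactSection_bijective C Q p pv g q)).toModuleIso.isIso_hom
  exact HomologicalComplex.Hom.isIso_of_components _

end Comparison

end TropIH

open CategoryTheory TropIH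

theorem proposition3p5 {X : Type*} [TopologicalSpace X] [T2Space X] [ParacompactSpace X]
    [SecondCountableTopology X] (𝒜 : RationalPolyhedralAtlas X) (C : OpenFaceStructure 𝒜)
    (𝒳 : Filtration X) (hC : C.IsStratified 𝒳) (pv : 𝒳.Perversity)
    (Q : Subring ℝ) [IsDedekindDomain Q] (p : ℕ) (g : Version) :
    ∃ e : compactSectionsComplex C Q p pv g ≅ intersectionComplex C Q p pv g,
      ∀ (q : ℕ) (ξ : (intersectionComplex C Q p pv g).X q),
        toGlobalSection C Q p pv g q ((e.inv.f q) ξ) = chainSection C Q p pv g q ξ :=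
  -- Paracompact Hausdorff spaces are regular, so `comparison` is available. It runs from chains to
  -- sections and is thus the inverse of the isomorphism asked for; its components are
  -- `chainSection` with restricted codomain, so the formula holds by definition.
  ⟨(asIso (comparison C Q p pv g)).symm, fun _ _ => rfl⟩
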